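/- **Setting.** Alice and Bob share an untrusted state, a unit vector $|\psi\rangle\in\mathcal H_A\otimes\mathcal H_B$, where $\mathcal H_A,\mathcal H_B$ are arbitrary complex Hilbert spaces (we write $S$ for the shared system). Alice's device has self-adjoint observables with square $1$, denoted $X_A,Y_A,Z_A,D_A,E^+_A,E^-_A,F_A$, on $\mathcal H_A$. Bob's device has such observables $X_B,Y_B,Z_B$ on $\mathcal H_B$. Nothing else is assumed about them. The corresponding ideal observables on a qubit are, for Alice, the Pauli matrices $X,Y,Z$ and $D=\frac{X+Z}{\sqrt2}$, $E^\pm=\frac{\pm X+Y}{\sqrt2}$, $F=\frac{Y+Z}{\sqrt2}$. For Bob they are given by the same expressions with $Y$ replaced by $-Y$. For a label $\sigma$ write $\sigma_{Q_A},\sigma_{Q_B}$ for the ideal observables of Alice and Bob. Let $|\phi^+\rangle=\frac1{\sqrt2}(|00\rangle+|11\rangle)$ on qubits $Q_A,Q_B$, and for an observable $T$ let $\Pi^{\pm}_T=\frac12(I\pm T)$. Put $M_B=iZ_BX_BY_B$, which is unitary and satisfies $Y_B=(-iX_BZ_B)M_B$. Let $V:\mathcal H_B\to\mathcal H_B\otimes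 Q_B\otimes R_B$ (with $Q_B$, $R_B$ qubits) be the reduced swap followed by the phase kickback, $$V|b\rangle=\sum_{k,l\in\{0,1\}}\tfrac12\bigl(I+(-1)^lM_B\bigr)\,X_B^k\,\tfrac12\bigl(I+(-1)^kZ_B\bigr)|b\rangle\otimes|k\rangle_{Q_B}|l\rangle_{R_B}.$$ For an outcome $\pm$ of Alice, put $a=0$ for $+$ and $a=1$ for $-$, and let $\bar\Phi=(|v\rangle\mapsto|v\rangle|a\rangle_{Q_A})\otimes V$. **Theorem.** There is a universal constant $C$ with the following property. Suppose that for each of the 14 pairs $\alpha\beta\in\{XX,XY,XZ,YY,YZ,ZZ,DX,DZ,E^+X,E^+Y,E^-X,E^-Y,FY,FZ\}$ the correlation is $\chi$-close to the ideal one, $$\bigl|\langle\psi|\alpha_A\otimes\beta_B|\psi\rangle-\langle\phi^+|\alpha_{Q_A}\otimes\beta_{Q_B}|\phi^+\rangle\bigr|\le\chi .$$ Then $V$ is an isometry, so that $\bar\Phi$ is a local isometry. Moreover, for every measurement $\sigma\in\{X,Y,Z,D,E^+,E^-,F\}$ of Alice and each outcome $\pm$ there is a unit vector $|junk_\sigma\rangle\in\mathcal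 H_A\otimes\mathcal H_B$ (it may depend on $\sigma$ and on the outcome) with $$\Bigl\|\bar\Phi\bigl(\sqrt2\,\Pi^{\pm}_{\sigma_A}|\psi\rangle\bigr)-\frac{1}{2\sqrt{p_\sigma}}\Bigl[(I+M_B)|junk_\sigma\rangle_S\,\Pi^{\pm}_{Z_{Q_A}}\Pi^{\pm}_{\sigma_{Q_B}}|\phi^+\rangle_Q|0\rangle_{R_B}+(I-M_B)|junk_\sigma\rangle_S\,\Pi^{\pm}_{Z_{Q_A}}\bigl(\Pi^{\pm}_{\sigma_{Q_B}}\bigr)^{*}|\phi^+\rangle_Q|1\rangle_{R_B}\Bigr]\Bigr\|_2\le\tilde\epsilon,\qquad\tilde\epsilon=C\chi^{1/4},$$ where $p_\sigma=\langle\phi^+|\Pi^{\pm}_{Z_{Q_A}}\Pi^{\pm}_{\sigma_{Q_A}}|\phi^+\rangle$ (so that the two-qubit vectors divided by $\sqrt{p_\sigma}$ are unit vectors) and $*$ denotes entrywise complex conjugation. In words, Bob's register $Q_B$ holds the ideal remotely prepared qubit up to complex conjugation, and $R_B$ flags the conjugation. -/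

import Mathlib

open scoped TensorProduct Kronecker ComplexConjugate

universe u v

noncomputable section

namespace RemotePrep

/-- The measurement settings of Alice's device; `Ep`, `Em` stand for `E⁺`, `E⁻`. -/
inductive AliceSetting
  | X | Y | Z | D | Ep | Em | F

/-- The measurement settings of Bob's device. -/
inductive BobSetting
  | X | Y | Z

/-- The 14 pairs of settings whose correlations are tested in the protocol. -/
def testedSettings : Set (AliceSetting × BobSetting) :=
  {(.X, .X), (.X, .Y), (.X, .Z), (.Y, .Y), (.Y, .Z), (.Z, .Z),
   (.D, .X), (.D, .Z), (.Ep, .X), (.Ep, .Y), (.Em, .X), (.Em, .Y), (.F, .Y), (.F, .Z)}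

/-! ### The reference experiment -/

def pauliX : Matrix (Fin 2) (Fin 2) ℂ := !![0, 1; 1, 0]
def pauliY : Matrix (Fin 2) (Fin 2) ℂ := !![0, -Complex.I; Complex.I, 0]
def pauliZ : Matrix (Fin 2) (Fin 2) ℂ := !![1, 0; 0, -1]

/-- The observable with label `σ` built from three given Pauli-like matrices:
`D = (X + Z)/√2`, `E^± = (±X + Y)/√2`, `F = (Y + Z)/√2`. -/
def combine (X Y Z : Matrix (Fin 2) (Fin 2) ℂ) : AliceSetting → Matrix (Fin 2) (Fin 2) ℂ
  | .X => X
  | .Y => Y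
  | .Z => Z
  | .D => ((1 / √2 : ℝ) : ℂ) • (X + Z)
  | .Ep => ((1 / √2 : ℝ) : ℂ) • (X + Y)
  | .Em => ((1 / √2 : ℝ) : ℂ) • (-X + Y)
  | .F => ((1 / √2 : ℝ) : ℂ) • (Y + Z)

/-- The ideal observable `σ_{Q_A}` on Alice's qubit (`Y_A = Y`). -/
def idealA : AliceSetting → Matrix (Fin 2) (Fin 2) ℂ :=
  combine pauliX pauliY pauliZ

/-- The ideal observable `σ_{Q_B}` with the same label on Bob's qubit (`Y_B = -Y`). -/
def idealB : AliceSetting → Matrix (Fin 2) (Fin 2) ℂ :=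
  combine pauliX (-pauliY) pauliZ

/-- A setting of Bob, seen as the label of an observable. -/
def BobSetting.label : BobSetting → AliceSetting
  | .X => .X
  | .Y => .Y
  | .Z => .Z

/-- The Bell state `(|00⟩ + |11⟩)/√2`. -/
def phiPlus : Fin 2 × Fin 2 → ℂ :=
  fun q => if q.1 = q.2 then ((1 / √2 : ℝ) : ℂ) else 0

/-- The expectation value `⟨φ⁺| T |φ⁺⟩`. -/
def bellExpect (T : Matrix (Fin 2 × Fin 2) (Fin 2 × Fin 2) ℂ) : ℂ :=
  star phiPlus ⬝ᵥ (T.mulVec phiPlus)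

/-- The ideal correlation `⟨φ⁺| α ⊗ β |φ⁺⟩`. -/
def idealCorrelation (α : AliceSetting) (β : BobSetting) : ℂ :=
  bellExpect (idealA α ⊗ₖ idealB β.label)

/-- The projector `(1 + (-1)^a T)/2` for outcome `a`, where `a = 0` is the outcome `+1` and
`a = 1` the outcome `-1`. -/
def matProj (a : Fin 2) (T : Matrix (Fin 2) (Fin 2) ℂ) : Matrix (Fin 2) (Fin 2) ℂ :=
  (1 / 2 : ℂ) • (1 + (-1 : ℂ) ^ (a : ℕ) • T)

/-- `p_σ = ⟨φ⁺| Π^±_{Z_{Q_A}} Π^±_{σ_{Q_A}} |φ⁺⟩`, which is also the squared norm of both vectors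
`refQubits a σ l` below. -/
def refWeight (a : Fin 2) (σ : AliceSetting) : ℝ :=
  (bellExpect ((matProj a (idealA .Z) * matProj a (idealA σ)) ⊗ₖ
    (1 : Matrix (Fin 2) (Fin 2) ℂ))).re

/-- For `l = 0` the vector `Π^±_{Z_{Q_A}} Π^±_{σ_{Q_B}} |φ⁺⟩`, for `l = 1` the vector
`Π^±_{Z_{Q_A}} (Π^±_{σ_{Q_B}})^* |φ⁺⟩`, with `*` the entrywise complex conjugate. -/
def refQubits (a : Fin 2) (σ : AliceSetting) (l : Fin 2) : Fin 2 × Fin 2 → ℂ :=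
  (matProj a (idealA .Z) ⊗ₖ
    (if l = 0 then matProj a (idealB σ) else (matProj a (idealB σ)).map conj)).mulVec phiPlus

/-! ### The physical experiment -/

variable {HA : Type u} [NormedAddCommGroup HA] [InnerProductSpace ℂ HA]
variable {HB : Type v} [NormedAddCommGroup HB] [InnerProductSpace ℂ HB]

/-- The Hilbert space tensor product `S = S_A ⊗ S_B`. -/
abbrev Shared (HA : Type u) [NormedAddCommGroup HA] [InnerProductSpace ℂ HA]
    (HB : Type v) [NormedAddCommGroup HB] [InnerProductSpace ℂ HB] : Type (max u v) :=
  UniformSpace.Completion (HA ⊗[ℂ] HB)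

/-- The operator `A ⊗ B` on the Hilbert space tensor product. -/
def tensorOp (A : HA →L[ℂ] HA) (B : HB →L[ℂ] HB) : Shared HA HB →L[ℂ] Shared HA HB :=
  (TensorProduct.mapL A B).completion

/-- A `±1`-valued observable of a projective measurement. -/
def IsBinaryObservable {H : Type*} [NormedAddCommGroup H] [InnerProductSpace ℂ H]
    [CompleteSpace H] (T : H →L[ℂ] H) : Prop :=
  IsSelfAdjoint T ∧ T * T = 1

/-- The tested correlations `⟨ψ| α ⊗ β |ψ⟩` are all `χ`-close to the ideal ones. -/
def CorrelationsClose (A : AliceSetting → HA →L[ℂ] HA) (B : BobSetting → HB →L[ℂ] HB)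
    (ψ : Shared HA HB) (χ : ℝ) : Prop :=
  ∀ q ∈ testedSettings,
    ‖inner ℂ ψ (tensorOp (A q.1) (B q.2) ψ) - idealCorrelation q.1 q.2‖ ≤ χ

/-- The projector `(1 + (-1)^a T)/2` for outcome `a`. -/
def opProj {H : Type*} [NormedAddCommGroup H] [InnerProductSpace ℂ H]
    (a : Fin 2) (T : H →L[ℂ] H) : H →L[ℂ] H :=
  (1 / 2 : ℂ) • (1 + (-1 : ℂ) ^ (a : ℕ) • T)

/-- The unitary `M_{S_B} = i Z_B X_B Y_B`, that is, the one with
`Y_B = (-i X_B Z_B) M_{S_B}`, where `-i X Z = -Y` on a qubit. -/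
def phaseOp (B : BobSetting → HB →L[ℂ] HB) : HB →L[ℂ] HB :=
  Complex.I • (B .Z * B .X * B .Y)

/-- The component of the reduced swap gate at `|k⟩` of the register `Q_B`. -/
def swapPart (B : BobSetting → HB →L[ℂ] HB) (k : Fin 2) : HB →L[ℂ] HB :=
  B .X ^ (k : ℕ) * opProj k (B .Z)

/-- The component of the phase kickback at `|l⟩` of the register `R_B`. -/
def kickPart (B : BobSetting → HB →L[ℂ] HB) (l : Fin 2) : HB →L[ℂ] HB :=
  opProj l (phaseOp B)

/-- `H ⊗ ℂ^ι` as the `ℓ²`-direct sum of copies of `H`, for a register with basis kets `|i⟩`. -/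
abbrev WithRegister (ι : Type) [Fintype ι] (H : Type*) : Type _ :=
  PiLp 2 (fun _ : ι => H)

/-- The local map `(v ↦ v ⊗ |a⟩_{Q_A}) ⊗ V` from `S` to `S ⊗ Q_A ⊗ Q_B ⊗ R_B`, for an isometry `V`
from `S_B` to `S_B ⊗ Q_B ⊗ R_B`. -/
def localIsometry (a : Fin 2) (V : HB →ₗᵢ[ℂ] WithRegister (Fin 2 × Fin 2) HB)
    (Ψ : Shared HA HB) : WithRegister (Fin 2 × Fin 2 × Fin 2) (Shared HA HB) :=
  WithLp.toLp 2 fun q =>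
    if q.1 = a then
      tensorOp (1 : HA →L[ℂ] HA) (PiLp.proj 2 (fun _ : Fin 2 × Fin 2 => HB) q.2 ∘L
        V.toContinuousLinearMap) Ψ
    else 0

/-- The ideal state
`1/(2 √p_σ) ∑_l (1 + (-1)^l M_{S_B}) |junk⟩_S ⊗ refQubits a σ l ⊗ |l⟩_{R_B}`. -/
def targetState (B : BobSetting → HB →L[ℂ] HB) (a : Fin 2) (σ : AliceSetting)
    (junk : Shared HA HB) : WithRegister (Fin 2 × Fin 2 × Fin 2) (Shared HA HB) :=
  WithLp.toLp 2 fun q =>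
    (((1 / √(refWeight a σ) : ℝ) : ℂ) * refQubits a σ q.2.2 (q.1, q.2.1)) •
      tensorOp (1 : HA →L[ℂ] HA) (opProj q.2.2 (phaseOp B)) junk

end RemotePrep

end

open RemotePrep

/-! Put `δ = χ^(1/4)`. A correlation within `δ^4` of 1 makes the two observables agree on `ψ` to
order `δ^2`. Each of Alice's `D`, `E^±`, `F` has overlap `1/√2`, up to sign, with two observables of
Bob whose images of `ψ` are nearly orthogonal, hence acts on `ψ` as their normalized signed sum, to
order `δ` (`norm_sub_combination_le`). This second square root is where the exponent 1/4 comes from.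
As Alice's observable squares to 1, so does the sum, approximately; therefore Bob's observables
anticommute pairwise on `ψ` (`norm_anticommutator_le`). Trading Bob's operators for Alice's
commuting ones extends this to vectors such as `Y ψ` and `Z Y ψ` (`SelfTest.almostPauli`).

In Bob's circuit `Z` then acts as a sign, `X` as a flip of `k`, and `Y` as a flip with phase `±i`
whose sign depends on `l`; this sign is the complex conjugation. For fixed `l`, the outputs at `k =
0, 1` of the steered state are combinations of the two outputs on `ψ`, with a coefficient matrix of
determinant `1 - x^2 - y^2 - z^2 = 0`. Rank one makes them proportional, in the ratio of the ideal
qubit (`norm_proportional_le`). The junk vector is the swap output at `k = a`, rescaled and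
normalized; its norm is right because Bob's observables have nearly zero mean
(`abs_norm_sq_sub_le`). -/

noncomputable section

namespace RemotePrep

/-! ### Algebra of operators on the completed tensor product. -/

section Tensor

variable {HA : Type u} [NormedAddCommGroup HA] [InnerProductSpace ℂ HA]
variable {HB : Type v} [NormedAddCommGroup HB] [InnerProductSpace ℂ HB]

lemma tensorOp_coe (S : HA →L[ℂ] HA) (T : HB →L[ℂ] HB) (x : HA ⊗[ℂ] HB) :
    tensorOp S T (x : Shared HA HB) = ((TensorProduct.mapL S T x : HA ⊗[ℂ] HB) : Shared HA HB) :=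
  ContinuousLinearMap.completion_apply_coe _ _

lemma shared_ext {f g : Shared HA HB →L[ℂ] Shared HA HB}
    (h : ∀ x : HA ⊗[ℂ] HB, f (x : Shared HA HB) = g (x : Shared HA HB)) : f = g := by
  ext v
  induction v using UniformSpace.Completion.induction_on with
  | hp => exact isClosed_eq f.continuous g.continuous
  | ih x => exact h x

lemma tensorOp_mul (S S' : HA →L[ℂ] HA) (T T' : HB →L[ℂ] HB) :
    tensorOp (S * S') (T * T') = tensorOp S T * tensorOp S' T' := by
  refine shared_ext fun x => ?_
  simp only [tensorOp_coe, TensorProduct.mapL_mul, mul_apply_eq_comp]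

lemma tensorOp_one : tensorOp (1 : HA →L[ℂ] HA) (1 : HB →L[ℂ] HB) = 1 := by
  refine shared_ext fun x => ?_
  rw [tensorOp_coe]
  exact congrArg _ (DFunLike.congr_fun (TensorProduct.mapL_id_id (𝕜 := ℂ) (E := HA) (G := HB)) x)

lemma tensorOp_add_right (S : HA →L[ℂ] HA) (T T' : HB →L[ℂ] HB) :
    tensorOp S (T + T') = tensorOp S T + tensorOp S T' := by
  refine shared_ext fun x => ?_
  simp only [tensorOp_coe, TensorProduct.mapL_add_right, _root_.add_apply,
    UniformSpace.Completion.coe_add]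

lemma tensorOp_add_left (S S' : HA →L[ℂ] HA) (T : HB →L[ℂ] HB) :
    tensorOp (S + S') T = tensorOp S T + tensorOp S' T := by
  refine shared_ext fun x => ?_
  simp only [tensorOp_coe, TensorProduct.mapL_add_left, _root_.add_apply,
    UniformSpace.Completion.coe_add]

lemma tensorOp_smul_right (c : ℂ) (S : HA →L[ℂ] HA) (T : HB →L[ℂ] HB) :
    tensorOp S (c • T) = c • tensorOp S T := by
  refine shared_ext fun x => ?_
  simp only [tensorOp_coe, TensorProduct.mapL_smul_right, _root_.smul_apply,
    UniformSpace.Completion.coe_smul]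

lemma tensorOp_smul_left (c : ℂ) (S : HA →L[ℂ] HA) (T : HB →L[ℂ] HB) :
    tensorOp (c • S) T = c • tensorOp S T := by
  refine shared_ext fun x => ?_
  simp only [tensorOp_coe, TensorProduct.mapL_smul_left, _root_.smul_apply,
    UniformSpace.Completion.coe_smul]

lemma tensorOp_one_mul (T T' : HB →L[ℂ] HB) :
    tensorOp (1 : HA →L[ℂ] HA) (T * T') = tensorOp 1 T * tensorOp 1 T' := by
  rw [← tensorOp_mul, one_mul]

lemma tensorOp_mul_one (S S' : HA →L[ℂ] HA) :
    tensorOp (S * S') (1 : HB →L[ℂ] HB) = tensorOp S 1 * tensorOp S' 1 := by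
  rw [← tensorOp_mul, one_mul]

lemma tensorOp_one_pow (T : HB →L[ℂ] HB) (n : ℕ) :
    tensorOp (1 : HA →L[ℂ] HA) (T ^ n) = tensorOp 1 T ^ n := by
  induction n with
  | zero => simp [tensorOp_one]
  | succ n ih => rw [pow_succ, pow_succ, tensorOp_one_mul, ih]

lemma tensorOp_one_opProj (a : Fin 2) (T : HB →L[ℂ] HB) :
    tensorOp (1 : HA →L[ℂ] HA) (opProj a T) = opProj a (tensorOp 1 T) := by
  simp only [opProj, tensorOp_smul_right, tensorOp_add_right, tensorOp_one]

lemma tensorOp_opProj_one (a : Fin 2) (S : HA →L[ℂ] HA) :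
    tensorOp (opProj a S) (1 : HB →L[ℂ] HB) = opProj a (tensorOp S 1) := by
  simp only [opProj, tensorOp_smul_left, tensorOp_add_left, tensorOp_one]

lemma tensorOp_commute (S : HA →L[ℂ] HA) (T : HB →L[ℂ] HB) (v : Shared HA HB) :
    tensorOp S 1 (tensorOp 1 T v) = tensorOp 1 T (tensorOp S 1 v) := by
  rw [← mul_apply_eq_comp, ← mul_apply_eq_comp, ← tensorOp_mul,
    ← tensorOp_mul]
  simp

lemma tensorOp_eq_apply (S : HA →L[ℂ] HA) (T : HB →L[ℂ] HB) (v : Shared HA HB) :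
    tensorOp S T v = tensorOp S 1 (tensorOp 1 T v) := by
  rw [← mul_apply_eq_comp, ← tensorOp_mul]
  simp

/-- By density and bilinearity it suffices to check pure tensors, where the inner product
factorizes. -/
lemma inner_tensorOp_left [CompleteSpace HA] [CompleteSpace HB] {S : HA →L[ℂ] HA}
    {T : HB →L[ℂ] HB} (hS : IsSelfAdjoint S) (hT : IsSelfAdjoint T) (u v : Shared HA HB) :
    inner ℂ (tensorOp S T u) v = inner ℂ u (tensorOp S T v) := by
  induction u, v using UniformSpace.Completion.induction_on₂ with
  | hp =>
    refine isClosed_eq ?_ ?_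
    · exact (((tensorOp S T).continuous.comp continuous_fst).inner continuous_snd)
    · exact (continuous_fst.inner ((tensorOp S T).continuous.comp continuous_snd))
  | ih x y =>
    simp only [tensorOp_coe, UniformSpace.Completion.inner_coe]
    induction x using TensorProduct.induction_on with
    | zero => simp
    | add x x' hx hx' => simp only [map_add, inner_add_left, hx, hx']
    | tmul a b =>
      induction y using TensorProduct.induction_on with
      | zero => simp
      | add y y' hy hy' => simp only [map_add, inner_add_right, hy, hy']
      | tmul c d =>
        simp only [TensorProduct.mapL_tmul, TensorProduct.inner_tmul]
        have h1 : inner ℂ (S a) c = inner ℂ a (S c) := by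
          rw [← ContinuousLinearMap.adjoint_inner_left, ← ContinuousLinearMap.star_eq_adjoint, hS]
        have h2 : inner ℂ (T b) d = inner ℂ b (T d) := by
          rw [← ContinuousLinearMap.adjoint_inner_left, ← ContinuousLinearMap.star_eq_adjoint, hT]
        rw [h1, h2]

end Tensor

/-! ### Symmetric involutions and their outcome projections. -/

section Reflection

variable {H : Type*} [NormedAddCommGroup H] [InnerProductSpace ℂ H]

/-- A symmetric involution. -/
structure IsReflection (T : H →L[ℂ] H) : Prop where
  inner_left : ∀ u v, inner ℂ (T u) v = inner ℂ u (T v)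
  map_map : ∀ v, T (T v) = v

namespace IsReflection

variable {T : H →L[ℂ] H}

lemma inner_map_map (h : IsReflection T) (u v : H) : inner ℂ (T u) (T v) = inner ℂ u v := by
  rw [h.inner_left, h.map_map]

lemma norm_map (h : IsReflection T) (v : H) : ‖T v‖ = ‖v‖ := by
  have := h.inner_map_map v v
  rw [inner_self_eq_norm_sq_to_K, inner_self_eq_norm_sq_to_K] at this
  have h2 : ‖T v‖ ^ 2 = ‖v‖ ^ 2 := by exact_mod_cast this
  exact (sq_eq_sq₀ (norm_nonneg _) (norm_nonneg _)).1 h2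

lemma neg (h : IsReflection T) : IsReflection (-T) :=
  ⟨fun u v => by simp [h.inner_left], fun v => by simp [h.map_map]⟩

end IsReflection

lemma IsBinaryObservable.isReflection [CompleteSpace H] {T : H →L[ℂ] H}
    (h : IsBinaryObservable T) : IsReflection T where
  inner_left u v := by
    rw [← ContinuousLinearMap.adjoint_inner_left, ← ContinuousLinearMap.star_eq_adjoint, h.1]
  map_map v := by
    rw [← mul_apply_eq_comp, h.2]; rfl

lemma opProj_apply (a : Fin 2) (T : H →L[ℂ] H) (v : H) :
    opProj a T v = (1 / 2 : ℂ) • (v + (-1 : ℂ) ^ (a : ℕ) • T v) := by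
  simp [opProj]

lemma norm_opProj_le (a : Fin 2) {T : H →L[ℂ] H} (hT : ∀ v, ‖T v‖ = ‖v‖) (v : H) :
    ‖opProj a T v‖ ≤ ‖v‖ := by
  rw [opProj_apply, norm_smul]
  have h1 := norm_add_le v ((-1 : ℂ) ^ (a : ℕ) • T v)
  rw [norm_smul, norm_pow, norm_neg, norm_one, one_pow, one_mul, hT] at h1
  norm_num
  linarith

/-- Parallelogram law for the two outcomes. -/
lemma norm_sq_opProj_add {T : H →L[ℂ] H} (hT : ∀ v, ‖T v‖ = ‖v‖) (v : H) :
    ‖opProj 0 T v‖ ^ 2 + ‖opProj 1 T v‖ ^ 2 = ‖v‖ ^ 2 := by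
  rw [opProj_apply, opProj_apply, norm_smul, norm_smul]
  have := parallelogram_law_with_norm ℂ v (T v)
  rw [hT] at this
  norm_num [← sub_eq_add_neg]
  nlinarith

lemma IsReflection.norm_sq_opProj {T : H →L[ℂ] H} (hT : IsReflection T) (a : Fin 2) (v : H) :
    ‖opProj a T v‖ ^ 2 = (‖v‖ ^ 2 + (-1 : ℝ) ^ (a : ℕ) * (inner ℂ v (T v)).re) / 2 := by
  rw [opProj_apply, norm_smul, mul_pow, norm_add_sq (𝕜 := ℂ), norm_smul, hT.norm_map, inner_smul_right]
  fin_cases a <;> norm_num <;> ring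

/-- For a reflection, `opProj a T` is symmetric and idempotent. -/
lemma IsReflection.inner_opProj_opProj {T : H →L[ℂ] H} (hT : IsReflection T) (a : Fin 2)
    (u v : H) : inner ℂ (opProj a T u) (opProj a T v) = inner ℂ (opProj a T u) v := by
  simp only [opProj_apply, inner_smul_left, inner_smul_right, inner_add_left, inner_add_right,
    hT.inner_map_map, hT.inner_left]
  fin_cases a <;> simp <;> ring

end Reflection

section Tensor

variable {HA : Type u} [NormedAddCommGroup HA] [InnerProductSpace ℂ HA] [CompleteSpace HA]
variable {HB : Type v} [NormedAddCommGroup HB] [InnerProductSpace ℂ HB] [CompleteSpace HB]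

lemma IsBinaryObservable.tensorOp_left {S : HA →L[ℂ] HA} (hS : IsBinaryObservable S) :
    IsReflection (tensorOp S (1 : HB →L[ℂ] HB)) where
  inner_left := inner_tensorOp_left hS.1 (IsSelfAdjoint.one _)
  map_map v := by
    rw [← mul_apply_eq_comp, ← tensorOp_mul_one, hS.2, tensorOp_one]; rfl

lemma IsBinaryObservable.tensorOp_right {T : HB →L[ℂ] HB} (hT : IsBinaryObservable T) :
    IsReflection (tensorOp (1 : HA →L[ℂ] HA) T) where
  inner_left := inner_tensorOp_left (IsSelfAdjoint.one _) hT.1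
  map_map v := by
    rw [← mul_apply_eq_comp, ← tensorOp_one_mul, hT.2, tensorOp_one]; rfl

end Tensor

/-! ### Operator relations on the state forced by correlations. -/

section Correlations

variable {H : Type*} [NormedAddCommGroup H] [InnerProductSpace ℂ H]
variable {T P Q S : H →L[ℂ] H} {ψ : H} {δ : ℝ}

/-- Both images are unit vectors, so the squared distance is `2 - 2 Re ⟨ψ, T P ψ⟩`. -/
lemma norm_sub_le_of_correlation (hT : IsReflection T) (hP : IsReflection P) (hψ : ‖ψ‖ = 1)
    (h : ‖inner ℂ ψ (T (P ψ)) - 1‖ ≤ δ ^ 4) : ‖T ψ - P ψ‖ ≤ 2 * δ ^ 2 := by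
  have h1 : (inner ℂ (T ψ) (P ψ)).re ≥ 1 - δ ^ 4 := by
    rw [hT.inner_left]
    have := (Complex.abs_re_le_norm _).trans h
    rw [Complex.sub_re, Complex.one_re] at this
    linarith [(abs_le.1 this).1]
  have h2 : ‖T ψ - P ψ‖ ^ 2 ≤ (2 * δ ^ 2) ^ 2 := by
    rw [norm_sub_sq (𝕜 := ℂ), hT.norm_map, hP.norm_map, hψ, RCLike.re_eq_complex_re]
    nlinarith [sq_nonneg (δ ^ 2)]
  exact (sq_le_sq₀ (norm_nonneg _) (by positivity)).1 h2

/-- Lets later estimates be linear in `δ` without assuming `δ ≤ 1`: for large `δ` the trivial bound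
2 suffices. -/
lemma norm_sub_le_two_mul (hT : IsReflection T) (hP : IsReflection P) (hψ : ‖ψ‖ = 1)
    (hδ : 0 ≤ δ) (h : ‖T ψ - P ψ‖ ≤ 2 * δ ^ 2) : ‖T ψ - P ψ‖ ≤ 2 * δ := by
  rcases le_total δ 1 with h1 | h1
  · nlinarith
  · have := norm_sub_le (T ψ) (P ψ)
    rw [hT.norm_map, hP.norm_map, hψ] at this
    linarith

/-- An observable with correlation `1/√2` with each of two observables that are uncorrelated with
each other acts as their normalized sum. -/
lemma norm_sub_combination_le (hT : IsReflection T) (hP : IsReflection P) (hQ : IsReflection Q)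
    (hS : IsReflection S) (hψ : ‖ψ‖ = 1) (hδ : 0 ≤ δ) (hSP : ‖S ψ - P ψ‖ ≤ 2 * δ ^ 2)
    (hSQ : ‖inner ℂ ψ (S (Q ψ))‖ ≤ δ ^ 4)
    (hTP : ‖inner ℂ ψ (T (P ψ)) - (1 / √2 : ℝ)‖ ≤ δ ^ 4)
    (hTQ : ‖inner ℂ ψ (T (Q ψ)) - (1 / √2 : ℝ)‖ ≤ δ ^ 4) :
    ‖T ψ - ((1 / √2 : ℝ) : ℂ) • (P ψ + Q ψ)‖ ≤ 3 * δ := by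
  have hr : (1 / √2) ^ 2 = (1 / 2 : ℝ) := by
    rw [div_pow, Real.sq_sqrt (by norm_num)]; norm_num
  have hr0 : 0 < 1 / √2 := by positivity
  have hr1 : 1 / √2 ≤ 1 := by nlinarith
  set r := 1 / √2 with hrdef
  rcases le_total 1 δ with h1 | h1
  · have e1 := norm_sub_le (T ψ) ((r : ℂ) • (P ψ + Q ψ))
    have e2 := norm_add_le (P ψ) (Q ψ)
    rw [norm_smul, Complex.norm_real, Real.norm_of_nonneg hr0.le, hT.norm_map, hψ] at e1
    rw [hP.norm_map, hQ.norm_map, hψ] at e2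
    nlinarith [norm_nonneg (P ψ + Q ψ)]
  have hδ4 : δ ^ 4 ≤ δ ^ 2 := pow_le_pow_of_le_one hδ h1 (by norm_num)
  -- `P` and `Q` belong to the same party, so their overlap is not tested directly; replacing `P` by
  -- its partner `S` costs order `δ^2`, which dominates the error.
  have hPQ : (inner ℂ (P ψ) (Q ψ)).re ≤ 3 * δ ^ 2 := by
    have e : inner ℂ (P ψ) (Q ψ) = inner ℂ ψ (S (Q ψ)) - inner ℂ (S ψ - P ψ) (Q ψ) := by
      rw [inner_sub_left, hS.inner_left]; ring
    have e1 := norm_inner_le_norm (𝕜 := ℂ) (S ψ - P ψ) (Q ψ)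
    rw [hQ.norm_map, hψ, mul_one] at e1
    rw [e, Complex.sub_re]
    linarith [(abs_le.1 (Complex.abs_re_le_norm (inner ℂ ψ (S (Q ψ))))).2,
      (abs_le.1 (Complex.abs_re_le_norm (inner ℂ (S ψ - P ψ) (Q ψ)))).1]
  have key : ∀ R : H →L[ℂ] H, ‖inner ℂ ψ (T (R ψ)) - (r : ℝ)‖ ≤ δ ^ 4 →
      r - δ ^ 2 ≤ (inner ℂ (T ψ) (R ψ)).re := by
    intro R hR
    rw [hT.inner_left]
    have := (Complex.abs_re_le_norm _).trans hR
    rw [Complex.sub_re, Complex.ofReal_re] at this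
    linarith [(abs_le.1 this).1]
  have h2 : ‖T ψ - (r : ℂ) • (P ψ + Q ψ)‖ ^ 2 ≤ (3 * δ) ^ 2 := by
    rw [norm_sub_sq (𝕜 := ℂ), norm_smul, mul_pow, norm_add_sq (𝕜 := ℂ), hT.norm_map, hP.norm_map,
      hQ.norm_map, hψ, inner_smul_right, inner_add_right, Complex.norm_real, Real.norm_of_nonneg hr0.le, hr]
    simp only [RCLike.re_eq_complex_re, Complex.re_ofReal_mul, Complex.add_re]
    nlinarith [key P hTP, key Q hTQ]
  exact (sq_le_sq₀ (norm_nonneg _) (by positivity)).1 h2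

/-- With `r = 1/√2` and `e` the error vector, applying `T + r(P + Q)` to `e` cancels the cross
terms, since `T` commutes with `P` and `Q`. What is left is `1 - (P + Q)^2/2` on `ψ`, that is, minus
half the anticommutator. -/
lemma norm_anticommutator_le (hT : IsReflection T) (hP : IsReflection P) (hQ : IsReflection Q)
    (hTP : ∀ v, T (P v) = P (T v)) (hTQ : ∀ v, T (Q v) = Q (T v))
    (h : ‖T ψ - ((1 / √2 : ℝ) : ℂ) • (P ψ + Q ψ)‖ ≤ 3 * δ) :
    ‖P (Q ψ) + Q (P ψ)‖ ≤ 18 * δ := by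
  have hr : (1 / √2) ^ 2 = (1 / 2 : ℝ) := by
    rw [div_pow, Real.sq_sqrt (by norm_num)]; norm_num
  have hr0 : 0 < 1 / √2 := by positivity
  have hr1 : 1 / √2 ≤ 1 := by nlinarith
  set r := 1 / √2 with hrdef
  have hrc : (r : ℂ) * r = 1 / 2 := by
    rw [← sq, ← Complex.ofReal_pow, hr]; norm_num
  set e := T ψ - (r : ℂ) • (P ψ + Q ψ) with he
  have id1 : P (Q ψ) + Q (P ψ) = (-2 : ℂ) • T e - (2 * (r : ℂ)) • (P e + Q e) := by
    simp only [he, map_sub, map_smul, map_add, hT.map_map, hP.map_map, hQ.map_map, hTP, hTQ]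
    match_scalars <;> ring_nf <;> simp only [sq, hrc] <;> norm_num
  rw [id1]
  have e1 := norm_sub_le ((-2 : ℂ) • T e) ((2 * (r : ℂ)) • (P e + Q e))
  have e2 := norm_add_le (P e) (Q e)
  rw [norm_smul, norm_smul, norm_mul, Complex.norm_real, Real.norm_of_nonneg hr0.le,
    hT.norm_map, norm_neg, Complex.norm_ofNat] at e1
  rw [hP.norm_map, hQ.norm_map] at e2
  nlinarith [norm_nonneg (P e + Q e), norm_nonneg e]

/-- An approximate anticommutation relation on `v` carries over to a vector that is close to the
image of `v` under a commuting reflection. -/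
lemma norm_anticommutator_shift {c ε : ℝ} {v w : H} (hS : IsReflection S) (hP : IsReflection P)
    (hQ : IsReflection Q) (hSP : ∀ v, S (P v) = P (S v)) (hSQ : ∀ v, S (Q v) = Q (S v))
    (h : ‖P (Q v) + Q (P v)‖ ≤ c) (hw : ‖S v - w‖ ≤ ε) :
    ‖P (Q w) + Q (P w)‖ ≤ c + 2 * ε := by
  have e : P (Q w) + Q (P w) =
      S (P (Q v) + Q (P v)) - (P (Q (S v - w)) + Q (P (S v - w))) := by
    simp only [map_add, map_sub, hSP, hSQ]; abel
  rw [e]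
  have e1 := norm_sub_le (S (P (Q v) + Q (P v))) (P (Q (S v - w)) + Q (P (S v - w)))
  have e2 := norm_add_le (P (Q (S v - w))) (Q (P (S v - w)))
  rw [hS.norm_map] at e1
  simp only [hP.norm_map, hQ.norm_map] at e2
  linarith

/-- A reflection which approximately anticommutes with another one that is shared with the other
party has a small expectation value. -/
lemma norm_expectation_le {c ε : ℝ} (hS : IsReflection S) (hP : IsReflection P)
    (hQ : IsReflection Q) (hψ : ‖ψ‖ = 1) (hSQ : ∀ v, S (Q v) = Q (S v))
    (h : ‖P (Q ψ) + Q (P ψ)‖ ≤ c) (hw : ‖S ψ - P ψ‖ ≤ ε) :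
    ‖inner ℂ ψ (Q ψ)‖ ≤ c / 2 + ε := by
  have e : 2 * inner ℂ ψ (Q ψ) = inner ℂ (P ψ) (P (Q ψ) + Q (P ψ))
      + inner ℂ (S ψ - P ψ) (Q (S ψ)) + inner ℂ (P ψ) (Q (S ψ - P ψ)) := by
    simp only [map_sub, inner_add_right, inner_sub_left, inner_sub_right, hP.inner_map_map]
    rw [← hSQ, hS.inner_map_map]; ring
  have e0 := norm_add₃_le (a := inner ℂ (P ψ) (P (Q ψ) + Q (P ψ)))
    (b := inner ℂ (S ψ - P ψ) (Q (S ψ))) (c := inner ℂ (P ψ) (Q (S ψ - P ψ)))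
  have e1 := norm_inner_le_norm (𝕜 := ℂ) (P ψ) (P (Q ψ) + Q (P ψ))
  have e2 := norm_inner_le_norm (𝕜 := ℂ) (S ψ - P ψ) (Q (S ψ))
  have e3 := norm_inner_le_norm (𝕜 := ℂ) (P ψ) (Q (S ψ - P ψ))
  rw [← e, norm_mul, Complex.norm_ofNat] at e0
  simp only [hP.norm_map, hQ.norm_map, hS.norm_map, hψ, one_mul, mul_one] at e1 e2 e3
  linarith

end Correlations

/-! ### Swap and phase kickback under approximate Pauli relations. -/

section Qubit

variable {H : Type*} [NormedAddCommGroup H] [InnerProductSpace ℂ H]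

/-- Three reflections that approximately anticommute on the vectors reached from `ψ` in the
analysis of the swap gate and the phase kickback. -/
structure AlmostPauli (X Y Z : H →L[ℂ] H) (ψ : H) (c : ℝ) : Prop where
  reflX : IsReflection X
  reflY : IsReflection Y
  reflZ : IsReflection Z
  xz : ‖X (Z ψ) + Z (X ψ)‖ ≤ c
  xz_y : ‖X (Z (Y ψ)) + Z (X (Y ψ))‖ ≤ c
  yz : ‖Y (Z ψ) + Z (Y ψ)‖ ≤ c
  xy : ‖X (Y ψ) + Y (X ψ)‖ ≤ c
  xy_z : ‖X (Y (Z ψ)) + Y (X (Z ψ))‖ ≤ c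
  xy_y : ‖X (Y (Y ψ)) + Y (X (Y ψ))‖ ≤ c
  xy_zy : ‖X (Y (Z (Y ψ))) + Y (X (Z (Y ψ)))‖ ≤ c

/-- The reduced swap gate at `|k⟩`. -/
def swapOp (X Z : H →L[ℂ] H) (k : Fin 2) : H →L[ℂ] H :=
  X ^ (k : ℕ) * opProj k Z

/-- The phase kickback at `|l⟩`. -/
def kickOp (X Y Z : H →L[ℂ] H) (l : Fin 2) : H →L[ℂ] H :=
  opProj l (Complex.I • (Z * X * Y))

lemma swapOp_zero_apply (X Z : H →L[ℂ] H) (v : H) :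
    swapOp X Z 0 v = (1 / 2 : ℂ) • (v + Z v) := by
  simp [swapOp, opProj_apply]

lemma swapOp_one_apply (X Z : H →L[ℂ] H) (v : H) :
    swapOp X Z 1 v = (1 / 2 : ℂ) • (X v - X (Z v)) := by
  simp [swapOp, opProj_apply, sub_eq_add_neg]

lemma kickOp_apply (X Y Z : H →L[ℂ] H) (l : Fin 2) (v : H) :
    kickOp X Y Z l v = (1 / 2 : ℂ) • (v + ((-1 : ℂ) ^ (l : ℕ) * Complex.I) • Z (X (Y v))) := by
  simp [kickOp, opProj_apply, smul_smul]

variable {X Y Z : H →L[ℂ] H} {ψ : H} {c : ℝ}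

lemma norm_kickOp_le (hX : IsReflection X) (hY : IsReflection Y) (hZ : IsReflection Z) (l : Fin 2)
    (v : H) : ‖kickOp X Y Z l v‖ ≤ ‖v‖ :=
  norm_opProj_le l (fun v => by simp [norm_smul, hX.norm_map, hY.norm_map, hZ.norm_map]) v

lemma norm_swapOp_le (hX : IsReflection X) (hZ : IsReflection Z) (k : Fin 2) (v : H) :
    ‖swapOp X Z k v‖ ≤ ‖v‖ := by
  have h := norm_opProj_le k hZ.norm_map v
  fin_cases k
  · simpa [swapOp] using h
  · simpa [swapOp, hX.norm_map] using h

lemma swapOp_map_Z (hZ : IsReflection Z) (k : Fin 2) (v : H) :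
    swapOp X Z k (Z v) = (-1 : ℂ) ^ (k : ℕ) • swapOp X Z k v := by
  fin_cases k
  · simp [swapOp_zero_apply, hZ.map_map, add_comm]
  · simp only [Fin.mk_one, swapOp_one_apply, hZ.map_map]
    match_scalars <;> simp

namespace AlmostPauli

/-- The difference is half the `X`, `Z` anticommutator on `ψ`, up to a sign and a factor `X`. -/
lemma norm_swapOp_map_X_sub_le (h : AlmostPauli X Y Z ψ c) (k : Fin 2) :
    ‖swapOp X Z k (X ψ) - swapOp X Z (1 - k) ψ‖ ≤ c := by
  have h0 : ‖(1 / 2 : ℂ) • (X (Z ψ) + Z (X ψ))‖ ≤ c := by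
    rw [norm_smul]; norm_num; linarith [h.xz, norm_nonneg (X (Z ψ) + Z (X ψ))]
  obtain rfl | rfl : k = 0 ∨ k = 1 := by omega
  · have e : swapOp X Z 0 (X ψ) - swapOp X Z (1 - 0) ψ = (1 / 2 : ℂ) • (X (Z ψ) + Z (X ψ)) := by
      rw [sub_zero, swapOp_zero_apply, swapOp_one_apply]
      module
    rwa [e]
  · have e : swapOp X Z 1 (X ψ) - swapOp X Z (1 - 1) ψ =
        -X ((1 / 2 : ℂ) • (X (Z ψ) + Z (X ψ))) := by
      rw [sub_self, swapOp_zero_apply, swapOp_one_apply, h.reflX.map_map, map_smul, map_add,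
        h.reflX.map_map]
      module
    rwa [e, norm_neg, h.reflX.norm_map]

/-- For exact Pauli relations, `M = i Z X Y` is a central involution and `Y = -i X Z M`: the
kickback turns `M` into `(-1)^l`, the swap turns `Z` into a sign and `X` into a flip. -/
lemma norm_kickOp_swapOp_map_Y_sub_le (h : AlmostPauli X Y Z ψ c) (k l : Fin 2) :
    ‖kickOp X Y Z l (swapOp X Z k (Y ψ)) - ((-1 : ℂ) ^ (l : ℕ) * (-1 : ℂ) ^ (k : ℕ) * Complex.I) •
      kickOp X Y Z l (swapOp X Z (1 - k) ψ)‖ ≤ 2 * c := by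
  have hX := h.reflX
  have hY := h.reflY
  have hZ := h.reflZ
  -- The defect is a quarter of six anticommutators, moved by isometries; `6/4 ≤ 2`.
  have bound : ∀ a b d e f g : H, ‖a‖ ≤ c → ‖b‖ ≤ c → ‖d‖ ≤ c → ‖e‖ ≤ c → ‖f‖ ≤ c → ‖g‖ ≤ c →
      ‖(1 / 4 : ℂ) • (a + b + d + ((-1 : ℂ) ^ (l : ℕ) * Complex.I) • (e + f + g))‖ ≤ 2 * c := by
    intro a b d e f g ha hb hd he hf hg
    have e1 := norm_add_le (a + b + d) (((-1 : ℂ) ^ (l : ℕ) * Complex.I) • (e + f + g))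
    have e2 := norm_add₃_le (a := a) (b := b) (c := d)
    have e3 := norm_add₃_le (a := e) (b := f) (c := g)
    rw [norm_smul] at e1 ⊢
    rw [norm_mul, norm_pow, norm_neg, norm_one, one_pow, Complex.norm_I, one_mul, one_mul] at e1
    rw [show ‖(1 / 4 : ℂ)‖ = 1 / 4 by norm_num]
    linarith [norm_nonneg a]
  have hs : ((-1 : ℂ) ^ (l : ℕ)) ^ 2 = 1 := by rw [← pow_mul, mul_comm, pow_mul]; simp
  obtain rfl | rfl : k = 0 ∨ k = 1 := by omega
  · have e : kickOp X Y Z l (swapOp X Z 0 (Y ψ)) -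
        ((-1 : ℂ) ^ (l : ℕ) * (-1 : ℂ) ^ ((0 : Fin 2) : ℕ) * Complex.I) •
          kickOp X Y Z l (swapOp X Z (1 - 0) ψ) =
        (1 / 4 : ℂ) • (Z (X (X (Y ψ) + Y (X ψ))) + -Z (X (X (Y (Z ψ)) + Y (X (Z ψ)))) +
          Z (Y (Z ψ) + Z (Y ψ)) + ((-1 : ℂ) ^ (l : ℕ) * Complex.I) • (X (Z ψ) + Z (X ψ) +
          -Z (X (Z ψ) + Z (X ψ)) + Z (X (Y (Y (Z ψ) + Z (Y ψ)))))) := by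
      rw [sub_zero]
      simp only [swapOp_zero_apply, swapOp_one_apply, kickOp_apply, Fin.val_zero, pow_zero]
      generalize (-1 : ℂ) ^ (l : ℕ) = s at hs
      simp only [map_smul, map_add, map_sub, hX.map_map, hY.map_map, hZ.map_map]
      match_scalars <;> ring_nf <;> try (simp only [Complex.I_sq, hs]; ring)
    rw [e]
    apply bound <;> try simp only [norm_neg, hX.norm_map, hY.norm_map, hZ.norm_map]
    exacts [h.xy, h.xy_z, h.yz, h.xz, h.xz, h.yz]
  · have e : kickOp X Y Z l (swapOp X Z 1 (Y ψ)) -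
        ((-1 : ℂ) ^ (l : ℕ) * (-1 : ℂ) ^ ((1 : Fin 2) : ℕ) * Complex.I) •
          kickOp X Y Z l (swapOp X Z (1 - 1) ψ) =
        (1 / 4 : ℂ) • (-(X (Z (Y ψ)) + Z (X (Y ψ))) + -Z (X (Y (Z ψ) + Z (Y ψ))) +
          Z (X (Z (Y ψ)) + Z (X (Y ψ))) + ((-1 : ℂ) ^ (l : ℕ) * Complex.I) •
          (Z (X (X (Y (Y ψ)) + Y (X (Y ψ)))) + -Z (X (X (Y (Z (Y ψ))) + Y (X (Z (Y ψ))))) +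
          Z (Y (Y (Z ψ) + Z (Y ψ))))) := by
      rw [sub_self]
      simp only [swapOp_zero_apply, swapOp_one_apply, kickOp_apply, Fin.val_one, pow_one]
      generalize (-1 : ℂ) ^ (l : ℕ) = s at hs
      simp only [map_smul, map_add, map_sub, hX.map_map, hY.map_map, hZ.map_map]
      match_scalars <;> ring_nf <;> try (simp only [Complex.I_sq, hs]; ring)
    rw [e]
    apply bound <;> try simp only [norm_neg, hX.norm_map, hY.norm_map, hZ.norm_map]
    exacts [h.xz_y, h.yz, h.xz_y, h.xy_y, h.xy_zy, h.yz]

end AlmostPauli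
end Qubit

/-! ### Bob's output on the state steered by Alice. -/

section Preparation

variable {H : Type*} [NormedAddCommGroup H] [InnerProductSpace ℂ H]
variable {X Y Z T : H →L[ℂ] H} {ψ : H} {c ε x y z : ℝ}

lemma sign_sq (a : Fin 2) : ((-1 : ℂ) ^ (a : ℕ)) ^ 2 = 1 := by
  rw [← pow_mul, mul_comm, pow_mul]; simp

lemma norm_sign (a : Fin 2) : ‖(-1 : ℂ) ^ (a : ℕ)‖ = 1 := by simp

lemma norm_sign_mul_le {a l : Fin 2} {t : ℂ} (ht : ‖t‖ = 1) (hxyz : x ^ 2 + y ^ 2 + z ^ 2 = 1) :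
    ‖(-1 : ℂ) ^ (a : ℕ) * (x + (-1 : ℂ) ^ (l : ℕ) * t * Complex.I * y)‖ ≤ 2 := by
  have h1 := norm_add_le (x : ℂ) ((-1 : ℂ) ^ (l : ℕ) * t * Complex.I * y)
  rw [norm_mul, norm_mul, norm_mul, norm_sign, ht, Complex.norm_I, Complex.norm_real,
    Complex.norm_real, Real.norm_eq_abs, Real.norm_eq_abs] at h1
  rw [norm_mul, norm_sign]
  have h2 : |x| ≤ 1 := abs_le_one_iff_mul_self_le_one.2 (by nlinarith)
  have h3 : |y| ≤ 1 := abs_le_one_iff_mul_self_le_one.2 (by nlinarith)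
  linarith

namespace AlmostPauli

/-- The output of Bob's circuit on the state steered by Alice, expanded in the outputs on `ψ`. -/
lemma norm_expansion_le (h : AlmostPauli X Y Z ψ c) (hxyz : x ^ 2 + y ^ 2 + z ^ 2 = 1)
    (hT : ‖T ψ - ((x : ℂ) • X ψ + (y : ℂ) • Y ψ + (z : ℂ) • Z ψ)‖ ≤ ε) (a k l : Fin 2) :
    ‖(2 : ℂ) • kickOp X Y Z l (swapOp X Z k (opProj a T ψ)) -
      ((1 + (-1 : ℂ) ^ (a : ℕ) * (-1 : ℂ) ^ (k : ℕ) * z) • kickOp X Y Z l (swapOp X Z k ψ) +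
        ((-1 : ℂ) ^ (a : ℕ) * (x + (-1 : ℂ) ^ (l : ℕ) * (-1 : ℂ) ^ (k : ℕ) * Complex.I * y)) •
          kickOp X Y Z l (swapOp X Z (1 - k) ψ))‖ ≤ ε + 3 * c := by
  set e := T ψ - ((x : ℂ) • X ψ + (y : ℂ) • Y ψ + (z : ℂ) • Z ψ) with he
  have hTe : T ψ = e + ((x : ℂ) • X ψ + (y : ℂ) • Y ψ + (z : ℂ) • Z ψ) := by rw [he]; abel
  -- The `Z` term is exact, so the defect has three sources: `e`, the flip by `X` (at most `c`) and
  -- the flip by `Y` (at most `2c`).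
  have id1 : (2 : ℂ) • kickOp X Y Z l (swapOp X Z k (opProj a T ψ)) -
      ((1 + (-1 : ℂ) ^ (a : ℕ) * (-1 : ℂ) ^ (k : ℕ) * z) • kickOp X Y Z l (swapOp X Z k ψ) +
        ((-1 : ℂ) ^ (a : ℕ) * (x + (-1 : ℂ) ^ (l : ℕ) * (-1 : ℂ) ^ (k : ℕ) * Complex.I * y)) •
          kickOp X Y Z l (swapOp X Z (1 - k) ψ)) =
      (-1 : ℂ) ^ (a : ℕ) • (kickOp X Y Z l (swapOp X Z k e) +
        (x : ℂ) • kickOp X Y Z l (swapOp X Z k (X ψ) - swapOp X Z (1 - k) ψ) +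
        (y : ℂ) • (kickOp X Y Z l (swapOp X Z k (Y ψ)) -
          ((-1 : ℂ) ^ (l : ℕ) * (-1 : ℂ) ^ (k : ℕ) * Complex.I) •
            kickOp X Y Z l (swapOp X Z (1 - k) ψ))) := by
    rw [opProj_apply, hTe]
    simp only [map_add, map_sub, map_smul, swapOp_map_Z h.reflZ]
    module
  have h1 := norm_add₃_le (a := kickOp X Y Z l (swapOp X Z k e))
    (b := (x : ℂ) • kickOp X Y Z l (swapOp X Z k (X ψ) - swapOp X Z (1 - k) ψ))
    (c := (y : ℂ) • (kickOp X Y Z l (swapOp X Z k (Y ψ)) -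
      ((-1 : ℂ) ^ (l : ℕ) * (-1 : ℂ) ^ (k : ℕ) * Complex.I) •
        kickOp X Y Z l (swapOp X Z (1 - k) ψ)))
  rw [id1, norm_smul, norm_sign, one_mul]
  rw [norm_smul, norm_smul, Complex.norm_real, Complex.norm_real, Real.norm_eq_abs,
    Real.norm_eq_abs] at h1
  have e1 := (norm_kickOp_le h.reflX h.reflY h.reflZ l (swapOp X Z k e)).trans
    (norm_swapOp_le h.reflX h.reflZ k e)
  have e2 := (norm_kickOp_le h.reflX h.reflY h.reflZ l
    (swapOp X Z k (X ψ) - swapOp X Z (1 - k) ψ)).trans (h.norm_swapOp_map_X_sub_le k)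
  have e3 := h.norm_kickOp_swapOp_map_Y_sub_le k l
  have h2 : |x| ≤ 1 := abs_le_one_iff_mul_self_le_one.2 (by nlinarith)
  have h3 : |y| ≤ 1 := abs_le_one_iff_mul_self_le_one.2 (by nlinarith)
  have e4 := mul_le_mul h2 e2 (norm_nonneg _) zero_le_one
  have e5 := mul_le_mul h3 e3 (norm_nonneg _) zero_le_one
  linarith

/-- The expansions at `k = a` and `k = 1 - a` have linearly dependent coefficient rows because the
Bloch vector has length one; cross-multiplying eliminates the outputs on `ψ`. -/
lemma norm_proportional_le (h : AlmostPauli X Y Z ψ c) (hxyz : x ^ 2 + y ^ 2 + z ^ 2 = 1)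
    (hT : ‖T ψ - ((x : ℂ) • X ψ + (y : ℂ) • Y ψ + (z : ℂ) • Z ψ)‖ ≤ ε) (a l : Fin 2) :
    ‖(1 + z : ℂ) • kickOp X Y Z l (swapOp X Z (1 - a) (opProj a T ψ)) -
      ((-1 : ℂ) ^ (a : ℕ) * (x + (-1 : ℂ) ^ (l : ℕ) * -(-1 : ℂ) ^ (a : ℕ) * Complex.I * y)) •
        kickOp X Y Z l (swapOp X Z a (opProj a T ψ))‖ ≤ 2 * (ε + 3 * c) := by
  have e1 := h.norm_expansion_le hxyz hT a (1 - a) l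
  have e2 := h.norm_expansion_le hxyz hT a a l
  have ht : (-1 : ℂ) ^ ((1 - a : Fin 2) : ℕ) = -(-1 : ℂ) ^ (a : ℕ) := by fin_cases a <;> simp
  rw [ht, sub_sub_cancel] at e1
  have hab := norm_sign_mul_le (a := a) (l := l) (t := -(-1 : ℂ) ^ (a : ℕ)) (by simp) hxyz
  have hs := sign_sq a
  have hl := sign_sq l
  have hz : ‖(1 + z : ℂ)‖ ≤ 2 := by
    have h1 := norm_add_le (1 : ℂ) z
    rw [norm_one, Complex.norm_real, Real.norm_eq_abs] at h1
    have h2 : |z| ≤ 1 := abs_le_one_iff_mul_self_le_one.2 (by nlinarith)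
    linarith
  have hc : (x : ℂ) ^ 2 + (y : ℂ) ^ 2 + (z : ℂ) ^ 2 = 1 := by exact_mod_cast hxyz
  generalize (-1 : ℂ) ^ (a : ℕ) = s at *
  generalize (-1 : ℂ) ^ (l : ℕ) = q at *
  generalize kickOp X Y Z l (swapOp X Z (1 - a) (opProj a T ψ)) = D at *
  generalize kickOp X Y Z l (swapOp X Z a (opProj a T ψ)) = D' at *
  generalize kickOp X Y Z l (swapOp X Z (1 - a) ψ) = w at *
  generalize kickOp X Y Z l (swapOp X Z a ψ) = w' at *
  have id1 : (1 + z : ℂ) • D - (s * (x + q * -s * Complex.I * y)) • D' =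
      (1 / 2 : ℂ) • ((1 + z : ℂ) • ((2 : ℂ) • D - ((1 + s * -s * z) • w +
        (s * (x + q * -s * Complex.I * y)) • w')) - (s * (x + q * -s * Complex.I * y)) •
        ((2 : ℂ) • D' - ((1 + s * s * z) • w' + (s * (x + q * s * Complex.I * y)) • w))) := by
    match_scalars
    · ring
    · ring
    -- The coefficient of `w` is minus half the determinant, hence zero by `hc`.
    · linear_combination (-1 / 2 : ℂ) * ((1 + z) * z + x ^ 2 -
        q ^ 2 * Complex.I ^ 2 * y ^ 2 * (s ^ 2 + 1)) * hs + (1 / 2 : ℂ) * Complex.I ^ 2 * y ^ 2 * hl +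
        (1 / 2 : ℂ) * y ^ 2 * Complex.I_sq - (1 / 2 : ℂ) * hc
    · linear_combination (-1 / 2 : ℂ) * s * (x - q * s * Complex.I * y) * z * hs
  rw [id1, norm_smul]
  have e3 := norm_sub_le ((1 + z : ℂ) • ((2 : ℂ) • D - ((1 + s * -s * z) • w +
        (s * (x + q * -s * Complex.I * y)) • w'))) ((s * (x + q * -s * Complex.I * y)) •
        ((2 : ℂ) • D' - ((1 + s * s * z) • w' + (s * (x + q * s * Complex.I * y)) • w)))
  rw [norm_smul, norm_smul] at e3
  have e4 := mul_le_mul hz e1 (norm_nonneg _) zero_le_two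
  have e5 := mul_le_mul hab e2 (norm_nonneg _) zero_le_two
  rw [show ‖(1 / 2 : ℂ)‖ = 1 / 2 by norm_num]
  linarith

/-- Each component of the output of Bob's circuit is proportional to the one at `k = a`. -/
lemma norm_component_le (h : AlmostPauli X Y Z ψ c) (hxyz : x ^ 2 + y ^ 2 + z ^ 2 = 1)
    (hz : 0 ≤ z) (hc : 0 ≤ c)
    (hT : ‖T ψ - ((x : ℂ) • X ψ + (y : ℂ) • Y ψ + (z : ℂ) • Z ψ)‖ ≤ ε) (a k l : Fin 2) {γ w : ℂ}
    (hγ : k = a → γ * w = (√2 : ℝ))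
    (hγ' : k ≠ a → γ * w = (√2 : ℝ) / (1 + z) *
      ((-1 : ℂ) ^ (a : ℕ) * (x + (-1 : ℂ) ^ (l : ℕ) * -(-1 : ℂ) ^ (a : ℕ) * Complex.I * y))) :
    ‖((√2 : ℝ) : ℂ) • kickOp X Y Z l (swapOp X Z k (opProj a T ψ)) -
      γ • kickOp X Y Z l (w • swapOp X Z a (opProj a T ψ))‖ ≤ 4 * (ε + 3 * c) := by
  have hε : 0 ≤ ε := (norm_nonneg _).trans hT
  rw [map_smul, smul_smul]
  by_cases hk : k = a
  · rw [hγ hk, hk, sub_self, norm_zero]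
    positivity
  · have hk' : k = 1 - a := by omega
    rw [hγ' hk, hk']
    have h1 := h.norm_proportional_le hxyz hT a l
    have hz0 : (1 + z : ℂ) ≠ 0 := by
      have : (1 + z) ≠ 0 := by positivity
      exact_mod_cast this
    -- Here `0 ≤ z` keeps the division by `1 + z` harmless.
    have h2 : ‖((√2 : ℝ) / (1 + z) : ℂ)‖ ≤ 2 := by
      have : ((√2 : ℝ) / (1 + z) : ℂ) = ((√2 / (1 + z) : ℝ) : ℂ) := by push_cast; rfl
      rw [this, Complex.norm_real, Real.norm_of_nonneg (by positivity), div_le_iff₀ (by positivity)]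
      nlinarith [Real.sqrt_le_sqrt (show (2 : ℝ) ≤ 2 ^ 2 by norm_num),
        Real.sqrt_sq (show (0 : ℝ) ≤ 2 by norm_num)]
    have h3 := mul_le_mul h2 h1 (norm_nonneg _) zero_le_two
    rw [← norm_smul, smul_sub, smul_smul, smul_smul, div_mul_cancel₀ _ hz0] at h3
    linarith

/-- The squared norm of the state left by the outcomes `a` of Alice and of Bob's `Z`. -/
lemma abs_norm_sq_sub_le {m : ℝ} (h : AlmostPauli X Y Z ψ c) (hψ : ‖ψ‖ = 1)
    (hxyz : x ^ 2 + y ^ 2 + z ^ 2 = 1) (hTr : IsReflection T) (hTZ : ∀ v, T (Z v) = Z (T v))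
    (hT : ‖T ψ - ((x : ℂ) • X ψ + (y : ℂ) • Y ψ + (z : ℂ) • Z ψ)‖ ≤ ε)
    (hX : ‖inner ℂ ψ (X ψ)‖ ≤ m) (hY : ‖inner ℂ ψ (Y ψ)‖ ≤ m) (hZ : ‖inner ℂ ψ (Z ψ)‖ ≤ m)
    (a : Fin 2) :
    |‖swapOp X Z a (opProj a T ψ)‖ ^ 2 - (1 + z) / 4| ≤ (4 * m + 2 * ε + c) / 4 := by
  have hx1 : |x| ≤ 1 := abs_le_one_iff_mul_self_le_one.2 (by nlinarith)
  have hy1 : |y| ≤ 1 := abs_le_one_iff_mul_self_le_one.2 (by nlinarith)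
  have hz1 : |z| ≤ 1 := abs_le_one_iff_mul_self_le_one.2 (by nlinarith)
  set e := T ψ - ((x : ℂ) • X ψ + (y : ℂ) • Y ψ + (z : ℂ) • Z ψ) with he
  have hTe : T ψ = e + ((x : ℂ) • X ψ + (y : ℂ) • Y ψ + (z : ℂ) • Z ψ) := by rw [he]; abel
  have hcomm : opProj a Z (opProj a T ψ) = opProj a T (opProj a Z ψ) := by
    simp only [opProj_apply, map_add, map_smul, hTZ]; module
  have hswap : ‖swapOp X Z a (opProj a T ψ)‖ = ‖opProj a T (opProj a Z ψ)‖ := by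
    rw [← hcomm]
    obtain rfl | rfl : a = 0 ∨ a = 1 := by omega
    · simp [swapOp]
    · simp [swapOp, h.reflX.norm_map]
  have hre : ∀ {u : ℂ} {b : ℝ}, ‖u‖ ≤ b → |u.re| ≤ b := fun hu =>
    (Complex.abs_re_le_norm _).trans hu
  have hmul : ∀ {u r b : ℝ}, |r| ≤ 1 → |u| ≤ b → |r * u| ≤ b := by
    intro u r b hr hu
    rw [abs_mul]; nlinarith [abs_nonneg u, abs_nonneg r]
  have hTψ : |(inner ℂ ψ (T ψ)).re| ≤ ε + 3 * m := by
    have h0 : |(inner ℂ ψ e).re| ≤ ε := by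
      refine hre ((norm_inner_le_norm _ _).trans ?_)
      rwa [hψ, one_mul]
    rw [hTe]
    simp only [inner_add_right, inner_smul_right, Complex.add_re, Complex.re_ofReal_mul]
    have h1 := hmul hx1 (hre hX)
    have h2 := hmul hy1 (hre hY)
    have h3 := hmul hz1 (hre hZ)
    rw [abs_le] at *
    constructor <;> linarith
  -- The real part of `⟨Z ψ, P ψ⟩` is half the expectation of the anticommutator.
  have hanti : ∀ {P : H →L[ℂ] H}, IsReflection P → ‖P (Z ψ) + Z (P ψ)‖ ≤ c →
      |(inner ℂ (Z ψ) (P ψ)).re| ≤ c / 2 := by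
    intro P hP hPZ
    have h1 : |(inner ℂ ψ (P (Z ψ) + Z (P ψ))).re| ≤ c := by
      refine hre ((norm_inner_le_norm _ _).trans ?_)
      rwa [hψ, one_mul]
    have h2 : (inner ℂ ψ (P (Z ψ))).re = (inner ℂ (Z ψ) (P ψ)).re := by
      rw [← hP.inner_left, ← inner_conj_symm, Complex.conj_re]
    rw [inner_add_right, ← h.reflZ.inner_left, Complex.add_re, h2] at h1
    rw [abs_le] at *
    constructor <;> linarith
  have hTZψ : |(inner ℂ (Z ψ) (T ψ)).re - z| ≤ ε + c := by
    have h0 : |(inner ℂ (Z ψ) e).re| ≤ ε := by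
      refine hre ((norm_inner_le_norm _ _).trans ?_)
      rwa [h.reflZ.norm_map, hψ, one_mul]
    have h1 := hmul hx1 (hanti h.reflX h.xz)
    have h2 := hmul hy1 (hanti h.reflY h.yz)
    rw [hTe]
    simp only [inner_add_right, inner_smul_right, Complex.add_re, Complex.re_ofReal_mul,
      h.reflZ.inner_map_map]
    rw [inner_self_eq_norm_sq_to_K, hψ]
    norm_num
    rw [abs_le] at *
    constructor <;> linarith
  have hnorm : ‖opProj a T (opProj a Z ψ)‖ ^ 2 = (1 + (-1 : ℝ) ^ (a : ℕ) * (inner ℂ ψ (Z ψ)).re +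
      (-1 : ℝ) ^ (a : ℕ) * (inner ℂ ψ (T ψ)).re + (inner ℂ (Z ψ) (T ψ)).re) / 4 := by
    have hT_proj : T (opProj a Z ψ) = opProj a Z (T ψ) := by
      simp only [opProj_apply, map_add, map_smul, hTZ]
    rw [hTr.norm_sq_opProj, h.reflZ.norm_sq_opProj, hT_proj, h.reflZ.inner_opProj_opProj, hψ,
      opProj_apply, inner_smul_left, inner_add_left, inner_smul_left]
    obtain rfl | rfl : a = 0 ∨ a = 1 := by omega
    · simp; ring
    · simp; ring
  rw [hswap, hnorm]
  have h1 := hre hZ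
  obtain rfl | rfl : a = 0 ∨ a = 1 := by omega
  all_goals
    simp only [Fin.val_zero, Fin.val_one, pow_zero, pow_one]
    rw [abs_le] at *
    constructor <;> linarith

end AlmostPauli

/-- Normalize `v`, using `|t - 1| ≤ |t^2 - 1|` for `t ≥ 0`. The unit vector `ψ` only serves the case
`v = 0`. -/
lemma exists_unit_norm_sub_le (hψ : ‖ψ‖ = 1) (v : H) :
    ∃ w : H, ‖w‖ = 1 ∧ ‖v - w‖ ≤ |‖v‖ ^ 2 - 1| := by
  by_cases hv : v = 0
  · exact ⟨ψ, hψ, by simp [hv, hψ]⟩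
  · have hv0 : 0 < ‖v‖ := norm_pos_iff.2 hv
    refine ⟨((‖v‖⁻¹ : ℝ) : ℂ) • v, ?_, ?_⟩
    · rw [norm_smul, Complex.norm_real, Real.norm_of_nonneg (by positivity),
        inv_mul_cancel₀ hv0.ne']
    · have e : v - ((‖v‖⁻¹ : ℝ) : ℂ) • v = ((1 - ‖v‖⁻¹ : ℝ) : ℂ) • v := by
        push_cast; module
      rw [e, norm_smul, Complex.norm_real, Real.norm_eq_abs]
      have e2 : |1 - ‖v‖⁻¹| * ‖v‖ = |‖v‖ - 1| := by
        calc |1 - ‖v‖⁻¹| * ‖v‖ = |1 - ‖v‖⁻¹| * |‖v‖| := by rw [abs_of_pos hv0]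
          _ = |(1 - ‖v‖⁻¹) * ‖v‖| := (abs_mul _ _).symm
          _ = |‖v‖ - 1| := by rw [sub_mul, inv_mul_cancel₀ hv0.ne', one_mul]
      rw [e2, show ‖v‖ ^ 2 - 1 = (‖v‖ - 1) * (‖v‖ + 1) by ring, abs_mul,
        abs_of_pos (show 0 < ‖v‖ + 1 by linarith)]
      nlinarith [abs_nonneg (‖v‖ - 1)]

end Preparation

/-! ### The ideal experiment in Bloch coordinates. -/

section Reference

/-- The Bloch vector of Alice's observable with the given label. -/
def bloch : AliceSetting → ℝ × ℝ × ℝ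
  | .X => (1, 0, 0)
  | .Y => (0, 1, 0)
  | .Z => (0, 0, 1)
  | .D => (1 / √2, 0, 1 / √2)
  | .Ep => (1 / √2, 1 / √2, 0)
  | .Em => (-(1 / √2), 1 / √2, 0)
  | .F => (0, 1 / √2, 1 / √2)

lemma inv_sqrt_two_sq : (1 / √2) ^ 2 = (1 / 2 : ℝ) := by
  rw [div_pow, Real.sq_sqrt (by norm_num)]; norm_num

lemma bloch_norm (σ : AliceSetting) :
    (bloch σ).1 ^ 2 + (bloch σ).2.1 ^ 2 + (bloch σ).2.2 ^ 2 = 1 := by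
  have := inv_sqrt_two_sq
  cases σ <;> simp only [bloch, neg_sq, this] <;> norm_num

lemma bloch_z_nonneg (σ : AliceSetting) : 0 ≤ (bloch σ).2.2 := by
  cases σ <;> simp [bloch]

/-- The matrix `x X + y Y + z Z`. -/
lemma combine_eq (σ : AliceSetting) (X Y Z : Matrix (Fin 2) (Fin 2) ℂ) :
    combine X Y Z σ = ((bloch σ).1 : ℂ) • X + ((bloch σ).2.1 : ℂ) • Y + ((bloch σ).2.2 : ℂ) • Z := by
  cases σ <;> simp [combine, bloch, smul_add]

lemma idealA_eq (σ : AliceSetting) :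
    idealA σ = !![((bloch σ).2.2 : ℂ), (bloch σ).1 - Complex.I * (bloch σ).2.1;
      (bloch σ).1 + Complex.I * (bloch σ).2.1, -(bloch σ).2.2] := by
  rw [idealA, combine_eq]
  ext i j
  fin_cases i <;> fin_cases j <;> simp [pauliX, pauliY, pauliZ] <;> ring

lemma idealB_eq (σ : AliceSetting) :
    idealB σ = !![((bloch σ).2.2 : ℂ), (bloch σ).1 + Complex.I * (bloch σ).2.1;
      (bloch σ).1 - Complex.I * (bloch σ).2.1, -(bloch σ).2.2] := by
  rw [idealB, combine_eq]
  ext i j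
  fin_cases i <;> fin_cases j <;> simp [pauliX, pauliY, pauliZ] <;> ring

/-- The Bell state pairs `S` with the transpose of `T`; this is why Bob's ideal `Y` carries a minus
sign. -/
lemma bellExpect_kronecker (S T : Matrix (Fin 2) (Fin 2) ℂ) :
    bellExpect (S ⊗ₖ T) = (∑ i, ∑ j, S i j * T i j) / 2 := by
  have h : ((1 / √2 : ℝ) : ℂ) * ((1 / √2 : ℝ) : ℂ) = 1 / 2 := by
    rw [← sq, ← Complex.ofReal_pow, inv_sqrt_two_sq]; norm_num
  simp only [bellExpect, Matrix.mulVec, dotProduct, Fintype.sum_prod_type, phiPlus,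
    Matrix.kroneckerMap_apply, Fin.sum_univ_two, Pi.star_apply]
  simp [-one_div, Complex.conj_ofReal, -Complex.ofReal_div]
  linear_combination (S 0 0 * T 0 0 + S 0 1 * T 0 1 + S 1 0 * T 1 0 + S 1 1 * T 1 1) * h

lemma idealCorrelation_eq (σ : AliceSetting) (β : BobSetting) :
    idealCorrelation σ β = (((bloch σ).1 * (bloch β.label).1 +
      (bloch σ).2.1 * (bloch β.label).2.1 + (bloch σ).2.2 * (bloch β.label).2.2 : ℝ) : ℂ) := by
  rw [idealCorrelation, bellExpect_kronecker, idealA_eq, idealB_eq]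
  simp [Fin.sum_univ_two]
  ring_nf
  simp

lemma refWeight_eq (a : Fin 2) (σ : AliceSetting) : refWeight a σ = (1 + (bloch σ).2.2) / 4 := by
  rw [refWeight, bellExpect_kronecker, idealA_eq, idealA_eq]
  fin_cases a <;> simp [matProj, Fin.sum_univ_two, Matrix.mul_apply, bloch] <;> ring

lemma refQubits_eq (a : Fin 2) (σ : AliceSetting) (l i k : Fin 2) :
    refQubits a σ l (i, k) = if i = a then ((1 / √2 : ℝ) : ℂ) *
      (if k = a then (1 + (bloch σ).2.2 : ℂ) / 2 else (-1 : ℂ) ^ (a : ℕ) * ((bloch σ).1 +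
        (-1 : ℂ) ^ (l : ℕ) * -(-1 : ℂ) ^ (a : ℕ) * Complex.I * (bloch σ).2.1) / 2) else 0 := by
  have hZ : bloch .Z = (0, 0, 1) := rfl
  have h2 : (starRingEnd ℂ) 2 = 2 := map_ofNat _ 2
  simp only [refQubits, Matrix.mulVec, dotProduct, Fintype.sum_prod_type, phiPlus,
    Matrix.kroneckerMap_apply, Fin.sum_univ_two, matProj, idealA_eq, idealB_eq, hZ]
  generalize ((1 / √2 : ℝ) : ℂ) = r
  generalize bloch σ = b
  fin_cases a <;> fin_cases l <;> fin_cases i <;> fin_cases k <;>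
    simp [Complex.conj_ofReal, h2] <;> ring

end Reference

/-! ### From tested correlations to the prepared state. -/

section SelfTest

variable {H : Type*} [NormedAddCommGroup H] [InnerProductSpace ℂ H]

/-- Commuting families of reflections whose correlations in the state `ψ` are `δ ^ 4`-close to the
ideal ones. -/
structure SelfTest (A : AliceSetting → H →L[ℂ] H) (B : BobSetting → H →L[ℂ] H) (ψ : H)
    (δ : ℝ) : Prop where
  reflA : ∀ σ, IsReflection (A σ)
  reflB : ∀ β, IsReflection (B β)
  comm : ∀ σ β v, A σ (B β v) = B β (A σ v)
  norm_eq_one : ‖ψ‖ = 1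
  nonneg : 0 ≤ δ
  correlation : ∀ q ∈ testedSettings,
    ‖inner ℂ ψ (A q.1 (B q.2 ψ)) - idealCorrelation q.1 q.2‖ ≤ δ ^ 4

namespace SelfTest

variable {A : AliceSetting → H →L[ℂ] H} {B : BobSetting → H →L[ℂ] H} {ψ : H} {δ : ℝ}

lemma correlation_le (h : SelfTest A B ψ δ) {σ : AliceSetting} {β : BobSetting} {r : ℝ}
    (hm : (σ, β) ∈ testedSettings)
    (hr : (bloch σ).1 * (bloch β.label).1 + (bloch σ).2.1 * (bloch β.label).2.1 +
      (bloch σ).2.2 * (bloch β.label).2.2 = r) :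
    ‖inner ℂ ψ (A σ (B β ψ)) - (r : ℂ)‖ ≤ δ ^ 4 := by
  have := h.correlation _ hm
  rwa [idealCorrelation_eq, hr] at this

lemma norm_pauli_sub_le_sq (h : SelfTest A B ψ δ) (β : BobSetting) :
    ‖A β.label ψ - B β ψ‖ ≤ 2 * δ ^ 2 := by
  refine norm_sub_le_of_correlation (h.reflA _) (h.reflB _) h.norm_eq_one ?_
  have := h.correlation_le (σ := β.label) (β := β) (r := 1)
    (by cases β <;> simp [testedSettings, BobSetting.label])
    (by cases β <;> simp [bloch, BobSetting.label])
  simpa using this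

lemma norm_pauli_sub_le (h : SelfTest A B ψ δ) (β : BobSetting) :
    ‖A β.label ψ - B β ψ‖ ≤ 2 * δ :=
  norm_sub_le_two_mul (h.reflA _) (h.reflB _) h.norm_eq_one h.nonneg (h.norm_pauli_sub_le_sq β)

lemma norm_D_sub_le (h : SelfTest A B ψ δ) :
    ‖A .D ψ - ((1 / √2 : ℝ) : ℂ) • (B .X ψ + B .Z ψ)‖ ≤ 3 * δ := by
  refine norm_sub_combination_le (h.reflA .D) (h.reflB .X) (h.reflB .Z) (h.reflA .X)
    h.norm_eq_one h.nonneg (h.norm_pauli_sub_le_sq .X) ?_ ?_ ?_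
  · simpa using h.correlation_le (σ := .X) (β := .Z) (r := 0) (by simp [testedSettings])
      (by simp [bloch, BobSetting.label])
  · exact h.correlation_le (by simp [testedSettings]) (by simp [bloch, BobSetting.label])
  · exact h.correlation_le (by simp [testedSettings]) (by simp [bloch, BobSetting.label])

lemma norm_Ep_sub_le (h : SelfTest A B ψ δ) :
    ‖A .Ep ψ - ((1 / √2 : ℝ) : ℂ) • (B .X ψ + B .Y ψ)‖ ≤ 3 * δ := by
  refine norm_sub_combination_le (h.reflA .Ep) (h.reflB .X) (h.reflB .Y) (h.reflA .X)
    h.norm_eq_one h.nonneg (h.norm_pauli_sub_le_sq .X) ?_ ?_ ?_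
  · simpa using h.correlation_le (σ := .X) (β := .Y) (r := 0) (by simp [testedSettings])
      (by simp [bloch, BobSetting.label])
  · exact h.correlation_le (by simp [testedSettings]) (by simp [bloch, BobSetting.label])
  · exact h.correlation_le (by simp [testedSettings]) (by simp [bloch, BobSetting.label])

lemma norm_Em_sub_le (h : SelfTest A B ψ δ) :
    ‖A .Em ψ - ((1 / √2 : ℝ) : ℂ) • ((-B .X) ψ + B .Y ψ)‖ ≤ 3 * δ := by
  -- Negating `X` on both sides keeps the pair matched and makes the negative correlation positive.
  refine norm_sub_combination_le (h.reflA .Em) (h.reflB .X).neg (h.reflB .Y) (h.reflA .X).neg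
    h.norm_eq_one h.nonneg ?_ ?_ ?_ ?_
  · have := h.norm_pauli_sub_le_sq .X
    rw [← norm_neg] at this
    have e : (-A .X) ψ - (-B .X) ψ = -(A BobSetting.X.label ψ - B .X ψ) := by
      simp only [_root_.neg_apply, BobSetting.label]
      abel
    rwa [e]
  · simpa using h.correlation_le (σ := .X) (β := .Y) (r := 0) (by simp [testedSettings])
      (by simp [bloch, BobSetting.label])
  · have := h.correlation_le (σ := .Em) (β := .X) (r := -(1 / √2)) (by simp [testedSettings])
      (by simp [bloch, BobSetting.label])
    rw [← norm_neg] at this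
    have e : inner ℂ ψ (A .Em ((-B .X) ψ)) - ((1 / √2 : ℝ) : ℂ) =
        -(inner ℂ ψ (A .Em (B .X ψ)) - ((-(1 / √2) : ℝ) : ℂ)) := by
      rw [_root_.neg_apply, map_neg, inner_neg_right, Complex.ofReal_neg]
      ring
    rwa [e]
  · exact h.correlation_le (by simp [testedSettings]) (by simp [bloch, BobSetting.label])

lemma norm_F_sub_le (h : SelfTest A B ψ δ) :
    ‖A .F ψ - ((1 / √2 : ℝ) : ℂ) • (B .Y ψ + B .Z ψ)‖ ≤ 3 * δ := by
  refine norm_sub_combination_le (h.reflA .F) (h.reflB .Y) (h.reflB .Z) (h.reflA .Y)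
    h.norm_eq_one h.nonneg (h.norm_pauli_sub_le_sq .Y) ?_ ?_ ?_
  · simpa using h.correlation_le (σ := .Y) (β := .Z) (r := 0) (by simp [testedSettings])
      (by simp [bloch, BobSetting.label])
  · exact h.correlation_le (by simp [testedSettings]) (by simp [bloch, BobSetting.label])
  · exact h.correlation_le (by simp [testedSettings]) (by simp [bloch, BobSetting.label])

/-- Alice's observables act on `ψ` as the corresponding combinations of Bob's. -/
lemma norm_bloch_sub_le (h : SelfTest A B ψ δ) (σ : AliceSetting) :
    ‖A σ ψ - (((bloch σ).1 : ℂ) • B .X ψ + ((bloch σ).2.1 : ℂ) • B .Y ψ +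
      ((bloch σ).2.2 : ℂ) • B .Z ψ)‖ ≤ 3 * δ := by
  have h0 := h.nonneg
  cases σ
  · simpa [bloch, BobSetting.label] using (h.norm_pauli_sub_le .X).trans (by linarith)
  · simpa [bloch, BobSetting.label] using (h.norm_pauli_sub_le .Y).trans (by linarith)
  · simpa [bloch, BobSetting.label] using (h.norm_pauli_sub_le .Z).trans (by linarith)
  · simpa [bloch, smul_add] using h.norm_D_sub_le
  · simpa [bloch, smul_add] using h.norm_Ep_sub_le
  · simpa [bloch, smul_add] using h.norm_Em_sub_le
  · simpa [bloch, smul_add] using h.norm_F_sub_le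

lemma norm_anticommutator_XZ_le (h : SelfTest A B ψ δ) :
    ‖B .X (B .Z ψ) + B .Z (B .X ψ)‖ ≤ 18 * δ :=
  norm_anticommutator_le (h.reflA .D) (h.reflB _) (h.reflB _) (h.comm _ _) (h.comm _ _)
    h.norm_D_sub_le

lemma norm_anticommutator_XY_le (h : SelfTest A B ψ δ) :
    ‖B .X (B .Y ψ) + B .Y (B .X ψ)‖ ≤ 18 * δ :=
  norm_anticommutator_le (h.reflA .Ep) (h.reflB _) (h.reflB _) (h.comm _ _) (h.comm _ _)
    h.norm_Ep_sub_le

lemma norm_anticommutator_YZ_le (h : SelfTest A B ψ δ) :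
    ‖B .Y (B .Z ψ) + B .Z (B .Y ψ)‖ ≤ 18 * δ :=
  norm_anticommutator_le (h.reflA .F) (h.reflB _) (h.reflB _) (h.comm _ _) (h.comm _ _)
    h.norm_F_sub_le

lemma norm_anticommutator_shift_le (h : SelfTest A B ψ δ) {P Q : BobSetting} (R : BobSetting)
    {c : ℝ} {v w : H} (hc : ‖B P (B Q v) + B Q (B P v)‖ ≤ c)
    (hw : ‖A R.label v - w‖ ≤ 2 * δ) : ‖B P (B Q w) + B Q (B P w)‖ ≤ c + 2 * (2 * δ) :=
  norm_anticommutator_shift (h.reflA _) (h.reflB _) (h.reflB _) (h.comm _ _) (h.comm _ _) hc hw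

/-- Each trade of a Bob operator for Alice's costs `4δ`. The worst vector, `Z Y ψ`, needs two, first
through `Z` and then through `Y`: `18 + 4 + 4 = 26`. -/
lemma almostPauli (h : SelfTest A B ψ δ) :
    AlmostPauli (B .X) (B .Y) (B .Z) ψ (26 * δ) := by
  have h0 := h.nonneg
  have hy := h.norm_pauli_sub_le .Y
  have hz := h.norm_pauli_sub_le .Z
  have hxyz := h.norm_anticommutator_shift_le _ h.norm_anticommutator_XY_le hz
  have hzy : ‖A BobSetting.Y.label (B .Z ψ) - B .Z (B .Y ψ)‖ ≤ 2 * δ := by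
    rwa [h.comm, ← map_sub, (h.reflB .Z).norm_map]
  exact
    { reflX := h.reflB _
      reflY := h.reflB _
      reflZ := h.reflB _
      xz := h.norm_anticommutator_XZ_le.trans (by linarith)
      yz := h.norm_anticommutator_YZ_le.trans (by linarith)
      xy := h.norm_anticommutator_XY_le.trans (by linarith)
      xz_y := (h.norm_anticommutator_shift_le _ h.norm_anticommutator_XZ_le hy).trans (by linarith)
      xy_z := hxyz.trans (by linarith)
      xy_y := (h.norm_anticommutator_shift_le _ h.norm_anticommutator_XY_le hy).trans (by linarith)
      xy_zy := (h.norm_anticommutator_shift_le _ hxyz hzy).trans (by linarith) }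

lemma norm_expectation_le (h : SelfTest A B ψ δ) (β : BobSetting) :
    ‖inner ℂ ψ (B β ψ)‖ ≤ 11 * δ := by
  have h0 := h.nonneg
  cases β
  · refine (RemotePrep.norm_expectation_le (h.reflA _) (h.reflB .Z) (h.reflB _) h.norm_eq_one
      (h.comm _ _) ?_ (h.norm_pauli_sub_le .Z)).trans (b := 18 * δ / 2 + 2 * δ) (by linarith)
    rw [add_comm]
    exact h.norm_anticommutator_XZ_le
  · exact (RemotePrep.norm_expectation_le (h.reflA _) (h.reflB .X) (h.reflB _) h.norm_eq_one
      (h.comm _ _) h.norm_anticommutator_XY_le (h.norm_pauli_sub_le .X)).trans (by linarith)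
  · exact (RemotePrep.norm_expectation_le (h.reflA _) (h.reflB .X) (h.reflB _) h.norm_eq_one
      (h.comm _ _) h.norm_anticommutator_XZ_le (h.norm_pauli_sub_le .X)).trans (by linarith)

/-- The remotely prepared state, one component of Bob's registers at a time. -/
lemma exists_junk (h : SelfTest A B ψ δ) (σ : AliceSetting) (a : Fin 2) :
    ∃ junk : H, ‖junk‖ = 1 ∧ ∀ k l : Fin 2,
      ‖((√2 : ℝ) : ℂ) • kickOp (B .X) (B .Y) (B .Z) l
          (swapOp (B .X) (B .Z) k (opProj a (A σ) ψ)) -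
        (((1 / √(refWeight a σ) : ℝ) : ℂ) * refQubits a σ l (a, k)) •
          kickOp (B .X) (B .Y) (B .Z) l junk‖ ≤ 500 * δ := by
  have h0 := h.nonneg
  have hP := h.almostPauli
  have hz := bloch_z_nonneg σ
  have hn := bloch_norm σ
  have hb := h.norm_bloch_sub_le σ
  have hs2 : (√2 : ℝ) ^ 2 = 2 := Real.sq_sqrt (by norm_num)
  have hs0 : (0 : ℝ) < √2 := by positivity
  rw [refWeight_eq]
  have hnorm := hP.abs_norm_sq_sub_le h.norm_eq_one hn (h.reflA σ) (h.comm _ _) hb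
    (h.norm_expectation_le .X) (h.norm_expectation_le .Y) (h.norm_expectation_le .Z) a
  have hcomp := fun k l => hP.norm_component_le (γ := ((1 / √((1 + (bloch σ).2.2) / 4) : ℝ) : ℂ) *
    refQubits a σ l (a, k)) (w := ((1 / √((1 + (bloch σ).2.2) / 4) : ℝ) : ℂ)) hn hz (by positivity) hb a k l
  have hab : ∀ l : Fin 2, ‖(-1 : ℂ) ^ (a : ℕ) * ((bloch σ).1 +
      (-1 : ℂ) ^ (l : ℕ) * -(-1 : ℂ) ^ (a : ℕ) * Complex.I * (bloch σ).2.1)‖ ≤ 2 := fun l =>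
    norm_sign_mul_le (by simp) hn
  simp only [refQubits_eq, if_true] at hcomp ⊢
  generalize (bloch σ).1 = x at *
  generalize (bloch σ).2.1 = y at *
  generalize (bloch σ).2.2 = z at *
  set p := (1 + z) / 4 with hp
  have hp0 : 1 / 4 ≤ p := by rw [hp]; linarith
  have hsp0 : 0 < √p := Real.sqrt_pos.2 (by linarith)
  have hspp : √p * √p = p := Real.mul_self_sqrt (by linarith)
  have hww : ((1 / √p : ℝ) : ℂ) * ((1 / √p : ℝ) : ℂ) = 4 / (1 + z) := by
    rw [← Complex.ofReal_mul, div_mul_div_comm, hspp, hp]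
    push_cast
    field_simp
  have hz1 : (1 + z : ℂ) ≠ 0 := by
    have : (1 + z) ≠ 0 := by positivity
    exact_mod_cast this
  have hr : ((1 / √2 : ℝ) : ℂ) = ((√2 : ℝ) : ℂ) / 2 := by
    rw [show (1 / √2 : ℝ) = √2 / 2 by field_simp; linarith]
    push_cast; rfl
  -- Taken before the kickback, so one vector serves both values of `l`.
  set J := ((1 / √p : ℝ) : ℂ) • swapOp (B .X) (B .Z) a (opProj a (A σ) ψ) with hJ
  obtain ⟨junk, hjunk, hJjunk⟩ := exists_unit_norm_sub_le h.norm_eq_one J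
  -- `76 = 4·11 + 2·3 + 26`; the factor `1/4` is lost to `p ≥ 1/4`.
  have hJnorm : |‖J‖ ^ 2 - 1| ≤ 76 * δ := by
    have e : ‖J‖ ^ 2 - 1 =
        (‖swapOp (B .X) (B .Z) a (opProj a (A σ) ψ)‖ ^ 2 - p) / p := by
      rw [hJ, norm_smul, Complex.norm_real, Real.norm_of_nonneg (by positivity), mul_pow, div_pow,
        sq (√p), hspp]
      field_simp
    rw [e, abs_div, abs_of_pos (by linarith : 0 < p), div_le_iff₀ (by linarith)]
    nlinarith
  refine ⟨junk, hjunk, fun k l => ?_⟩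
  have h1 := hcomp k l (by
    intro hk
    rw [if_pos hk, hr]
    have e : (4 / (1 + z) : ℂ) * (1 + z) = 4 := div_mul_cancel₀ _ hz1
    linear_combination ((√2 : ℝ) / 2 * (1 + z) / 2 : ℂ) * hww + ((√2 : ℝ) / 4 : ℂ) * e) (by
    intro hk
    rw [if_neg hk, hr]
    linear_combination ((√2 : ℝ) / 2 * ((-1 : ℂ) ^ (a : ℕ) *
      (x + (-1 : ℂ) ^ (l : ℕ) * -(-1 : ℂ) ^ (a : ℕ) * Complex.I * y) / 2) : ℂ) * hww)
  set γ : ℂ := ((1 / √p : ℝ) : ℂ) * (((1 / √2 : ℝ) : ℂ) * if k = a then (1 + z : ℂ) / 2 else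
    (-1 : ℂ) ^ (a : ℕ) *
      (x + (-1 : ℂ) ^ (l : ℕ) * -(-1 : ℂ) ^ (a : ℕ) * Complex.I * y) / 2) with hγ
  have hγ2 : ‖γ‖ ≤ 2 := by
    have h2 : ‖((1 / √p : ℝ) : ℂ)‖ ≤ 2 := by
      rw [Complex.norm_real, Real.norm_of_nonneg (by positivity), div_le_iff₀ hsp0]
      nlinarith
    have h3 : ‖((1 / √2 : ℝ) : ℂ)‖ ≤ 1 := by
      rw [Complex.norm_real, Real.norm_of_nonneg (by positivity), div_le_iff₀ hs0]
      nlinarith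
    have h4 : ‖(if k = a then (1 + z : ℂ) / 2 else (-1 : ℂ) ^ (a : ℕ) *
        (x + (-1 : ℂ) ^ (l : ℕ) * -(-1 : ℂ) ^ (a : ℕ) * Complex.I * y) / 2)‖ ≤ 1 := by
      split_ifs
      · rw [show (1 + z : ℂ) / 2 = (((1 + z) / 2 : ℝ) : ℂ) by push_cast; rfl, Complex.norm_real,
          Real.norm_of_nonneg (by positivity)]
        nlinarith
      · rw [norm_div, Complex.norm_ofNat]
        linarith [hab l]
    rw [hγ, norm_mul, norm_mul]
    have h5 := mul_le_mul h3 h4 (norm_nonneg _) zero_le_one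
    have h6 := mul_le_mul h2 h5 (by positivity) zero_le_two
    linarith
  have h2 : ‖γ • kickOp (B .X) (B .Y) (B .Z) l (J - junk)‖ ≤ 152 * δ := by
    rw [norm_smul]
    have h3 := (norm_kickOp_le (h.reflB .X) (h.reflB .Y) (h.reflB .Z) l (J - junk)).trans
      (hJjunk.trans hJnorm)
    have := mul_le_mul hγ2 h3 (norm_nonneg _) zero_le_two
    linarith
  -- Proportionality costs `4(3 + 3·26)δ = 324δ`, normalization `152δ`; the sum is below `500δ`.
  have h3 := norm_add_le _ _ |>.trans (add_le_add h1 h2)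
  rw [map_sub, smul_sub, sub_add_sub_cancel] at h3
  linarith

end SelfTest
end SelfTest

/-! ### Bob's isometry and the passage from components to the full norm. -/

section Assembly

variable {HA : Type u} [NormedAddCommGroup HA] [InnerProductSpace ℂ HA] [CompleteSpace HA]
variable {HB : Type v} [NormedAddCommGroup HB] [InnerProductSpace ℂ HB] [CompleteSpace HB]

lemma CorrelationsClose.selfTest {A : AliceSetting → HA →L[ℂ] HA} {B : BobSetting → HB →L[ℂ] HB}
    {ψ : Shared HA HB} {χ : ℝ} (hA : ∀ α, IsBinaryObservable (A α))
    (hB : ∀ β, IsBinaryObservable (B β)) (hψ : ‖ψ‖ = 1) (h : CorrelationsClose A B ψ χ) :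
    SelfTest (fun σ => tensorOp (A σ) (1 : HB →L[ℂ] HB)) (fun β => tensorOp (1 : HA →L[ℂ] HA) (B β))
      ψ (χ ^ (1 / 4 : ℝ)) where
  reflA σ := (hA σ).tensorOp_left
  reflB β := (hB β).tensorOp_right
  comm σ β v := tensorOp_commute _ _ v
  norm_eq_one := hψ
  nonneg := Real.rpow_nonneg ((norm_nonneg _).trans (h (.X, .X) (by simp [testedSettings]))) _
  correlation q hq := by
    have hχ : 0 ≤ χ := (norm_nonneg _).trans (h q hq)
    have := h q hq
    rw [tensorOp_eq_apply] at this
    rw [← Real.rpow_natCast, ← Real.rpow_mul hχ]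
    norm_num
    exact this

/-- The reduced swap followed by the phase kickback. -/
def swapKick (B : BobSetting → HB →L[ℂ] HB) (hB : ∀ β, IsBinaryObservable (B β)) :
    HB →ₗᵢ[ℂ] WithRegister (Fin 2 × Fin 2) HB where
  toFun b := WithLp.toLp 2 fun q => kickPart B q.2 (swapPart B q.1 b)
  map_add' b b' := by ext q; simp
  map_smul' c b := by ext q; simp
  norm_map' b := by
    have hR := fun β => (hB β).isReflection
    -- Norm preservation suffices for the parallelogram law; `phaseOp B` need not be self-adjoint.
    have hM : ∀ v, ‖phaseOp B v‖ = ‖v‖ := fun v => by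
      simp [phaseOp, norm_smul, (hR _).norm_map]
    refine (sq_eq_sq₀ (norm_nonneg _) (norm_nonneg _)).1 ?_
    change ‖(WithLp.toLp 2 fun q : Fin 2 × Fin 2 => kickPart B q.2 (swapPart B q.1 b) :
      WithRegister (Fin 2 × Fin 2) HB)‖ ^ 2 = _
    rw [PiLp.norm_sq_eq_of_L2, Fintype.sum_prod_type]
    simp only [Fin.sum_univ_two, kickPart, norm_sq_opProj_add hM]
    rw [← norm_sq_opProj_add (hR .Z).norm_map b]
    simp [swapPart, (hR _).norm_map]

/-- There are eight components, and `√8 ≤ 3`. -/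
lemma norm_withRegister_le {H : Type*} [NormedAddCommGroup H]
    {v : WithRegister (Fin 2 × Fin 2 × Fin 2) H} {b : ℝ} (hb : 0 ≤ b) (hv : ∀ q, ‖v q‖ ≤ b) :
    ‖v‖ ≤ 3 * b := by
  refine (sq_le_sq₀ (norm_nonneg _) (by positivity)).1 ?_
  rw [PiLp.norm_sq_eq_of_L2]
  have : ∑ q, ‖v q‖ ^ 2 ≤ ∑ _q : Fin 2 × Fin 2 × Fin 2, b ^ 2 :=
    Finset.sum_le_sum fun q _ => pow_le_pow_left₀ (norm_nonneg _) (hv q) 2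
  simp at this
  nlinarith [sq_nonneg b]

end Assembly

end RemotePrep
end

open RemotePrep
theorem theorem1 :
    ∃ C : ℝ,
      ∀ (HA : Type u) [NormedAddCommGroup HA] [InnerProductSpace ℂ HA] [CompleteSpace HA]
        (HB : Type v) [NormedAddCommGroup HB] [InnerProductSpace ℂ HB] [CompleteSpace HB]
        (A : AliceSetting → HA →L[ℂ] HA) (B : BobSetting → HB →L[ℂ] HB)
        (ψ : Shared HA HB) (χ : ℝ),
        (∀ α, IsBinaryObservable (A α)) → (∀ β, IsBinaryObservable (B β)) → ‖ψ‖ = 1 →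
        CorrelationsClose A B ψ χ →
        ∃ V : HB →ₗᵢ[ℂ] WithRegister (Fin 2 × Fin 2) HB,
          (∀ (b : HB) (k l : Fin 2), V b (k, l) = kickPart B l (swapPart B k b)) ∧
          ∀ (σ : AliceSetting) (a : Fin 2), ∃ junk : Shared HA HB, ‖junk‖ = 1 ∧
            ‖localIsometry a V
                ((√2 : ℂ) • tensorOp (opProj a (A σ)) (1 : HB →L[ℂ] HB) ψ) -
              targetState B a σ junk‖ ≤ C * χ ^ (1 / 4 : ℝ) := by
  refine ⟨1500, ?_⟩
  intro HA _ _ _ HB _ _ _ A B ψ χ hA hB hψ h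
  have hS := h.selfTest hA hB hψ
  refine ⟨swapKick B hB, fun b k l => rfl, fun σ a => ?_⟩
  obtain ⟨junk, hjunk, hbound⟩ := hS.exists_junk σ a
  refine ⟨junk, hjunk, ?_⟩
  have hδ := hS.nonneg
  rw [show (1500 : ℝ) * χ ^ (1 / 4 : ℝ) = 3 * (500 * χ ^ (1 / 4 : ℝ)) by ring]
  refine norm_withRegister_le (by positivity) ?_
  rintro ⟨i, k, l⟩
  rw [PiLp.sub_apply]
  -- Off `i = a` both vectors vanish: Alice's register is fixed at `a`.
  by_cases hi : i = a
  · subst hi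
    have hV : PiLp.proj 2 (fun _ : Fin 2 × Fin 2 => HB) (k, l) ∘L
        (swapKick B hB).toContinuousLinearMap = kickPart B l * swapPart B k := by
      ext b; rfl
    have hkick : tensorOp (1 : HA →L[ℂ] HA) (opProj l (phaseOp B)) =
        kickOp (tensorOp 1 (B .X)) (tensorOp 1 (B .Y)) (tensorOp 1 (B .Z)) l := by
      simp only [kickOp, phaseOp, tensorOp_one_opProj, tensorOp_smul_right, tensorOp_one_mul]
    have hswap : tensorOp (1 : HA →L[ℂ] HA) (swapPart B k) =
        swapOp (tensorOp 1 (B .X)) (tensorOp 1 (B .Z)) k := by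
      simp only [swapOp, swapPart, tensorOp_one_opProj, tensorOp_one_pow, tensorOp_one_mul]
    have h1 : localIsometry i (swapKick B hB)
        ((√2 : ℂ) • tensorOp (opProj i (A σ)) (1 : HB →L[ℂ] HB) ψ) (i, k, l) =
        (√2 : ℂ) • kickOp (tensorOp 1 (B .X)) (tensorOp 1 (B .Y)) (tensorOp 1 (B .Z)) l
          (swapOp (tensorOp 1 (B .X)) (tensorOp 1 (B .Z)) k
            (opProj i (tensorOp (A σ) (1 : HB →L[ℂ] HB)) ψ)) := by
      simp only [localIsometry, if_true, hV, tensorOp_one_mul, kickPart, hkick, hswap,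
        tensorOp_opProj_one, map_smul, mul_apply_eq_comp]
    have h2 : targetState B i σ junk (i, k, l) =
        (((1 / √(refWeight i σ) : ℝ) : ℂ) * refQubits i σ l (i, k)) •
          kickOp (tensorOp 1 (B .X)) (tensorOp 1 (B .Y)) (tensorOp 1 (B .Z)) l junk := by
      simp only [targetState, hkick]
    rw [h1, h2]
    exact hbound k l
  · have h1 : localIsometry a (swapKick B hB)
        ((√2 : ℂ) • tensorOp (opProj a (A σ)) (1 : HB →L[ℂ] HB) ψ) (i, k, l) = 0 := by
      simp only [localIsometry, if_neg hi]
    have h2 : targetState B a σ junk (i, k, l) = 0 := by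
      simp only [targetState, refQubits_eq, if_neg hi, mul_zero, zero_smul]
    rw [h1, h2, sub_zero, norm_zero]
    positivity
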